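/- Let $a_1,\dots,a_n\in\mathbb Z^d=\mathfrak t^d$ be nonzero vectors spanning a lattice of rank $d$, and let $\mathcal A=\{H_1,\dots,H_n\}$, $H_i=\{v\in(\mathfrak t^d)^*\mid v\cdot a_i=0\}$, be the corresponding central arrangement. Let $R$ be a commutative ring in which every nonzero $d\times d$ minor of the matrix $(a_1,\dots,a_n)$ is invertible (for example a $\mathbb Q$-algebra, or a field of sufficiently large characteristic, or any ring if $\mathcal A$ is unimodular). All schemes are over $R$. Put $T^k=\ker(T^n\to T^d)$ and $\mathfrak t^k=\ker(\mathbb Z^n\to\mathbb Z^d,\ x_i\mapsto a_i)$, let $z_i,w_i$ be the coordinates on $T^*\mathbb A^n$, and let $\mu^{-1}(0)\subseteq T^*\mathbb A^n$ be defined by the equations $\sum_i\lambda_i z_iw_i=0$ for $\lambda\in\mathfrak t^k$. The hypertoric variety of $\mathcal A$ is $\mathfrak M(\mathcal A)=\operatorname{Spec}\mathcal O(\mu^{-1}(0))^{T^k}$, where the $i$-th coordinate $t_i$ of $T^n$ acts by $z_i\mapsto t_iz_i$, $w_i\mapsto t_i^{-1}w_i$. A flat is a subset $F\subseteq\{1,\dots,n\}$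 with $F=\{i\mid H_i\supseteq\bigcap_{j\in F}H_j\}$; its rank $\operatorname{rk}F$ is the rank of the span of $\{a_i\mid i\in F\}$. For a flat $F$ let $\mathfrak M(\mathcal A_F)$ be the variety constructed in the same way from the vectors $a_i\in\mathbb Z^d$, $i\in F$, that is, from the torus $T^k\cap T^F$ acting on $T^*\mathbb A^F$, with base point $0=[0,0]$. Let $\mathring{\mathfrak M}(\mathcal A^F)\subseteq\mathfrak M(\mathcal A)$ be the locally closed subscheme of points $[z,w]$ (with $(z,w)$ in a closed orbit) such that $z_i=w_i=0$ if and only if $i\in F$: the subscheme cut out by the invariant functions lying in the ideal $(z_i,w_i\mid i\in F)$, minus the analogous closed subsets $z_j=w_j=0$ for $j\notin F$. A scheme $S$ with a base point $s\in S(R)$ is a normal slice to a locally closed subscheme $Z\subseteq Y$, smooth of relative dimension $m$ over $R$, if there are étale maps $U_\alpha\to Y$ whose images cover $Z$, and dominant étale maps $U_\alpha\to S\times\mathbb A^m$ over $R$, each of which restricts to a dominant map $U_\alpha\times_YZ\to\{s\}\times\mathbb A^m$. A stratification of $Y$ is a partition of $Y$ into smooth locally closed subschemes $Y_\beta$ indexed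 by a finite poset, together with normal slices $S_\beta$ to $Y_\beta$ in $Y$, such that $\overline{Y_\beta}=\bigsqcup_{\beta'\le\beta}Y_{\beta'}$ for all $\beta$. Then for every flat $F$, $\mathfrak M(\mathcal A_F)$ with base point $0$ is a normal slice to $\mathring{\mathfrak M}(\mathcal A^F)$ in $\mathfrak M(\mathcal A)$, and $\mathring{\mathfrak M}(\mathcal A^F)$ is smooth of relative dimension $2(d-\operatorname{rk}F)$. Hence the decomposition $\mathfrak M(\mathcal A)=\bigsqcup_F\mathring{\mathfrak M}(\mathcal A^F)$, indexed by the flats ordered by reverse inclusion, together with the normal slices $\mathfrak M(\mathcal A_F)$, is a stratification. -/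

import Mathlib

open CategoryTheory AlgebraicGeometry Matrix
open CategoryTheory.Limits (pullback pullback.fst pullback.snd)

universe u

noncomputable section

namespace Hypertoric

section Arrangement

variable {ι : Type} {d : ℕ}

/-- The central hyperplane `H_i = {v ∈ (𝔱ᵈ)^* | v ⬝ a_i = 0}` with integer normal vector `a_i`,
the `i`-th row of `a`. The arrangement is defined over the integers; the inclusions between
intersections of the `H_i` are the same over `ℤ`, `ℚ` and `ℝ`. -/
def hyperplane (a : Matrix ι (Fin d) ℤ) (i : ι) : Set (Fin d → ℤ) :=
  {v | a i ⬝ᵥ v = 0}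

/-- `H_S`, the intersection of the `H_i` with `i ∈ S`. -/
def hyperplaneInter (a : Matrix ι (Fin d) ℤ) (S : Finset ι) : Set (Fin d → ℤ) :=
  ⋂ i ∈ S, hyperplane a i

/-- `F` is a flat: `F = {i | H_i ⊇ H_F}`. -/
def IsFlat (a : Matrix ι (Fin d) ℤ) (F : Finset ι) : Prop :=
  ∀ i, i ∈ F ↔ hyperplaneInter a F ⊆ hyperplane a i

/-- The flats of the arrangement, ordered by inclusion. -/
abbrev Flat (a : Matrix ι (Fin d) ℤ) : Type := {F : Finset ι // IsFlat a F}

/-- The rank of the lattice spanned by the vectors `a_i`. -/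
def rank (a : Matrix ι (Fin d) ℤ) : ℕ :=
  Module.finrank ℤ (Submodule.span ℤ (Set.range a))

/-- The vectors `a_i` with `i ∈ F`, defining the localization `𝒜_F`. They are still regarded as
vectors in the lattice `𝔱ᵈ`. The torus and Lie algebra that are attached to them below are thus
`T̂ = ker (T^F → Tᵈ) = T^k ∩ T^F` and `𝔱̂ = ker (𝔱^F → 𝔱ᵈ) = 𝔱^k ∩ 𝔱^F`. -/
def localization (a : Matrix ι (Fin d) ℤ) (F : Finset ι) : Matrix F (Fin d) ℤ :=
  a.submatrix (fun i : F => (i : ι)) id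

end Arrangement

section Variety

variable {ι : Type} [Fintype ι] [DecidableEq ι] {d : ℕ} (a : Matrix ι (Fin d) ℤ)
variable (R : Type u) [CommRing R]

/-- The lattice `𝔱^k`, the kernel of `𝔱ⁿ → 𝔱ᵈ`, `x_i ↦ a_i`. -/
def lieKernel : Submodule ℤ (ι → ℤ) := LinearMap.ker a.vecMulLinear

/-- The character group of `T^k = ker (Tⁿ → Tᵈ)`: the cokernel of the map
`(𝔱ᵈ)^* → (𝔱ⁿ)^*`, `v ↦ (v ⬝ a_i)_i`, of character lattices. -/
abbrev CharGroup : Type := (ι → ℤ) ⧸ LinearMap.range a.mulVecLin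

/-- The restriction to `T^k` of the `i`-th coordinate character of `Tⁿ`. -/
def coordChar (i : ι) : CharGroup a := Submodule.Quotient.mk (Pi.single i 1)

/-- The coordinate ring of `T^*𝔸ⁿ` over `R`: `Sum.inl i` is `z_i` and `Sum.inr i` is `w_i`. -/
abbrev CotRing (ι : Type) (R : Type u) [CommRing R] : Type u := MvPolynomial (ι ⊕ ι) R

/-- The coordinate `z_i`. -/
def zVar (i : ι) : CotRing ι R := MvPolynomial.X (Sum.inl i)

/-- The coordinate `w_i`. -/
def wVar (i : ι) : CotRing ι R := MvPolynomial.X (Sum.inr i)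

/-- The component `∑ λ_i z_i w_i` along `λ ∈ 𝔱^k` of the moment map
`μ (z, w) = ι^* ∑ (z_i w_i) e_i ∈ (𝔱^k)^*`. -/
def momentComponent (l : ι → ℤ) : CotRing ι R := ∑ i, l i • (zVar R i * wVar R i)

/-- The ideal of `μ⁻¹(0)`. -/
def momentIdeal : Ideal (CotRing ι R) :=
  Ideal.span (momentComponent R '' (lieKernel a : Set (ι → ℤ)))

/-- The coordinate ring of `μ⁻¹(0)`. -/
abbrev MomentRing : Type u := CotRing ι R ⧸ momentIdeal a R

/-- The restriction of functions from `T^*𝔸ⁿ` to `μ⁻¹(0)`. -/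
abbrev toMomentRing : CotRing ι R →ₐ[R] MomentRing a R := Ideal.Quotient.mkₐ R (momentIdeal a R)

/-- The action of `T^k` on `T^*𝔸ⁿ`, restricted to `μ⁻¹(0)`, on functions. The coordinate ring of
`T^k × μ⁻¹(0)` is the group algebra of the character group of `T^k` over that of `μ⁻¹(0)`;
`z_i` goes to `χ_i ⊗ z_i` and `w_i` to `χ_i⁻¹ ⊗ w_i`. -/
def coactionPoly : CotRing ι R →ₐ[R] AddMonoidAlgebra (MomentRing a R) (CharGroup a) :=
  MvPolynomial.aeval (Sum.elim
    (fun i => AddMonoidAlgebra.single (coordChar a i) (toMomentRing a R (zVar R i)))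
    (fun i => AddMonoidAlgebra.single (-coordChar a i) (toMomentRing a R (wVar R i))))

lemma coactionPoly_momentComponent (l : ι → ℤ) :
    coactionPoly a R (momentComponent R l) =
      AddMonoidAlgebra.single 0 (toMomentRing a R (momentComponent R l)) := by
  have h : ∀ i, coactionPoly a R (zVar R i * wVar R i) =
      AddMonoidAlgebra.singleZeroRingHom (toMomentRing a R (zVar R i * wVar R i)) := by
    intro i
    simp [coactionPoly, zVar, wVar, AddMonoidAlgebra.single_mul_single]
  change _ = AddMonoidAlgebra.singleZeroRingHom (toMomentRing a R (momentComponent R l))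
  simp only [momentComponent, map_sum, map_zsmul, h]

lemma coactionPoly_eq_zero (p : CotRing ι R) (hp : p ∈ momentIdeal a R) :
    coactionPoly a R p = 0 := by
  have hle : momentIdeal a R ≤ RingHom.ker (coactionPoly a R) := by
    refine Ideal.span_le.mpr ?_
    rintro _ ⟨l, hl, rfl⟩
    have h0 : toMomentRing a R (momentComponent R l) = 0 :=
      Ideal.Quotient.eq_zero_iff_mem.mpr (Ideal.subset_span ⟨l, hl, rfl⟩)
    change coactionPoly a R _ = 0
    rw [coactionPoly_momentComponent, h0, AddMonoidAlgebra.single_zero]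
  exact hle hp

/-- The map `ν^*` on functions induced by the action map `ν : T^k × μ⁻¹(0) → μ⁻¹(0)`. -/
def coaction : MomentRing a R →ₐ[R] AddMonoidAlgebra (MomentRing a R) (CharGroup a) :=
  Ideal.Quotient.liftₐ (momentIdeal a R) (coactionPoly a R) (coactionPoly_eq_zero a R)

/-- The `T^k`-invariant functions on `μ⁻¹(0)`: those `f` with `ν^* f = 1 ⊗ f`. -/
def invariants : Subalgebra R (MomentRing a R) :=
  AlgHom.equalizer (coaction a R)
    (IsScalarTower.toAlgHom R (MomentRing a R) (AddMonoidAlgebra (MomentRing a R) (CharGroup a)))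

/-- The hypertoric variety `𝔐(𝒜) = Spec (𝒪(μ⁻¹(0))^{T^k})` over `R` of the central arrangement
with normal vectors `a_i`. -/
abbrev hypertoric : Scheme.{u} := Spec (CommRingCat.of (invariants a R))

/-- The structure morphism of `𝔐(𝒜)`. -/
def hypertoricToBase : hypertoric a R ⟶ Spec (CommRingCat.of R) :=
  Spec.map (CommRingCat.ofHom (algebraMap R (invariants a R)))

set_option linter.unusedSectionVars false in
lemma aeval_zero_eq_zero (p : CotRing ι R) (hp : p ∈ momentIdeal a R) :
    (MvPolynomial.aeval (fun _ => (0 : R)) : CotRing ι R →ₐ[R] R) p = 0 := by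
  have hle : momentIdeal a R ≤
      RingHom.ker (MvPolynomial.aeval (fun _ => (0 : R)) : CotRing ι R →ₐ[R] R) := by
    refine Ideal.span_le.mpr ?_
    rintro _ ⟨l, -, rfl⟩
    change (MvPolynomial.aeval (fun _ => (0 : R)) : CotRing ι R →ₐ[R] R) _ = 0
    simp [momentComponent, zVar, wVar]
  exact hle hp

/-- Evaluation of invariant functions at the point `z = w = 0` of `μ⁻¹(0)`. -/
def evalOrigin : invariants a R →ₐ[R] R :=
  (Ideal.Quotient.liftₐ (momentIdeal a R) (MvPolynomial.aeval (fun _ => (0 : R)))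
    (aeval_zero_eq_zero a R)).comp (invariants a R).val

/-- The base point `[0, 0]` of `𝔐(𝒜)`, an `R`-valued point. -/
def origin : Spec (CommRingCat.of R) ⟶ hypertoric a R :=
  Spec.map (CommRingCat.ofHom (evalOrigin a R).toRingHom)

/-- The ideal of the closed subscheme of `𝔐(𝒜)` given by the equations `z_i = w_i = 0` for `i ∈ S`,
that is, the ideal of those invariant functions that vanish on the closed subscheme
`z_i = w_i = 0` (`i ∈ S`) of `μ⁻¹(0)`. A geometric point of `𝔐(𝒜)` lies on this subscheme if and
only if the closed orbit `[z, w]` over it satisfies the equations. -/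
def vanishingIdeal (S : Finset ι) : Ideal (invariants a R) :=
  Ideal.comap (invariants a R).val
    (Ideal.span (⋃ i ∈ S, {toMomentRing a R (zVar R i), toMomentRing a R (wVar R i)}))

/-- The closed subset `z_i = w_i = 0` of `𝔐(𝒜)`. -/
def vanishingLocus (i : ι) : Set (hypertoric a R) :=
  PrimeSpectrum.zeroLocus (vanishingIdeal a R {i} : Set (invariants a R))

/-- The closed subscheme `z_i = w_i = 0 (i ∈ F)` of `𝔐(𝒜)`. -/
abbrev closedStratum (F : Finset ι) : Scheme.{u} :=
  Spec (CommRingCat.of (invariants a R ⧸ vanishingIdeal a R F))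

/-- The inclusion of the closed subscheme `z_i = w_i = 0 (i ∈ F)`. -/
def closedStratumι (F : Finset ι) : closedStratum a R F ⟶ hypertoric a R :=
  Spec.map (CommRingCat.ofHom (Ideal.Quotient.mk (vanishingIdeal a R F)))

/-- The open subset of `𝔐(𝒜)` on which no `i ∉ F` has `z_i = w_i = 0`. -/
def nonvanishing (F : Finset ι) : (hypertoric a R).Opens where
  carrier := ⋂ i ∈ (Fᶜ : Finset ι), (vanishingLocus a R i)ᶜ
  is_open' := isOpen_biInter_finset fun _ _ =>
    (PrimeSpectrum.isClosed_zeroLocus _).isOpen_compl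

/-- The stratum of `𝔐(𝒜)` where `z_i = w_i = 0` if and only if `i ∈ F`. -/
abbrev stratum (F : Finset ι) : Scheme.{u} :=
  (closedStratumι a R F ⁻¹ᵁ nonvanishing a R F).toScheme

/-- The inclusion of the stratum into `𝔐(𝒜)`. -/
def stratumι (F : Finset ι) : stratum a R F ⟶ hypertoric a R :=
  (closedStratumι a R F ⁻¹ᵁ nonvanishing a R F).ι ≫ closedStratumι a R F

end Variety

section Slices

variable {X S Y Z : Scheme.{u}}

/-- `𝔸^m` over a scheme. -/
abbrev AffSp (m : ℕ) (T : Scheme.{u}) : Scheme.{u} := 𝔸(ULift.{u} (Fin m); T)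

/-- Let `S` and `Y` be schemes over `X`, let `s` be a base point of `S`, that is, a section of
`S → X`, and let `i : Z → Y` be a locally closed subscheme that is smooth of (relative) dimension
`m` over `X`. Then `S` is a normal slice to `Z` in `Y` if a neighbourhood of `Z` has an étale cover
by schemes `U_α` with dominant étale maps `g_α : U_α → S × 𝔸^m` over `X`, such that each `g_α`
restricts to a dominant map from `U_α ∩ Z = U_α ×_Y Z` to `{s} × 𝔸^m`. -/
structure IsNormalSlice (pS : S ⟶ X) (s : X ⟶ S) (pY : Y ⟶ X) (i : Z ⟶ Y) (m : ℕ) : Prop where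
  section_base : s ≫ pS = 𝟙 X
  immersion : IsImmersion i
  smooth_dim : SmoothOfRelativeDimension m (i ≫ pY)
  exists_cover : ∃ (A : Type u) (U : A → Scheme.{u}) (f : ∀ α, U α ⟶ Y)
    (g : ∀ α, U α ⟶ AffSp m S) (h : ∀ α, pullback (f α) i ⟶ AffSp m X),
      (∀ α, Etale (f α)) ∧
      (∀ z : Z, ∃ α, i z ∈ Set.range (f α)) ∧
      (∀ α, Etale (g α) ∧ IsDominant (g α) ∧
        g α ≫ (AffSp m S ↘ S) ≫ pS = f α ≫ pY) ∧
      (∀ α, pullback.fst (f α) i ≫ g α = h α ≫ AffineSpace.map (ULift.{u} (Fin m)) s ∧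
        IsDominant (h α))

/-- A stratification of a scheme `Y` over `X`: a partition of `Y` into smooth, locally closed
subschemes `ST b`, indexed by a finite poset `B`, with normal slices `SL b` with base points `s b`,
such that the closure of each piece is the union of the pieces with smaller or equal index. -/
structure IsStratification {B : Type} [PartialOrder B] (pY : Y ⟶ X)
    (ST : B → Scheme.{u}) (i : ∀ b, ST b ⟶ Y)
    (SL : B → Scheme.{u}) (pS : ∀ b, SL b ⟶ X) (s : ∀ b, X ⟶ SL b) : Prop where
  finite_index : Finite B
  immersion : ∀ b, IsImmersion (i b)
  smooth : ∀ b, Smooth (i b ≫ pY)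
  partition : ∀ y : Y, ∃! b, y ∈ Set.range (i b)
  slice : ∀ b, ∃ m : ℕ, IsNormalSlice (pS b) (s b) pY (i b) m
  closure_eq : ∀ b, closure (Set.range (i b)) = ⋃ b' ≤ b, Set.range (i b')

end Slices

end Hypertoric

end

/-!
# Hypertoric varieties are stratified by flats

The ring of invariants of `𝔐(𝒜)` is spanned by products of the functions `u_i = z_i w_i` and of
the invariant monomials `m_w`, one for each `w ∈ (𝔱ᵈ)^*`: `m_w` is the product of the
`z_i^{w ⬝ a_i}` with `w ⬝ a_i ≥ 0` and the `w_i^{-w ⬝ a_i}` with `w ⬝ a_i ≤ 0`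
(`mem_span_invariants`). The `u_i` satisfy the same linear relations as the `a_i`, and
`m_w m_{w'}` is `m_{w + w'}` times a monomial in the `u_i` (`invMono_mul`).

*Coordinates.* Cramer's rule expresses every `a_i` through a maximal independent family of the
`a_j` that begins with a maximal independent family in `F` (`AdaptedBasis`). The coefficients are
quotients of maximal minors, so over `R` each is zero or a unit. Hence the `u_i` generate a
polynomial ring `P` in `d` variables, in which the image of `u_i` is a linear form that is not a
zero divisor. Sending `m_w` to a Laurent monomial times a product of such forms identifies the
invariants with an explicit subring of a Laurent polynomial ring over `P`
(`exists_invariants_embedding`). The divisibility conditions that define this subring depend on a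
choice of signs, one for each `i`.

*Charts.* Fix a flat `F` of corank `m`, and `w` orthogonal to the `a_i` with `i ∈ F`. Splitting
`(𝔱ᵈ)^*` along `F`, and choosing the signs at `i` to be that of `w ⬝ a_i`, one compares the
embeddings for `𝒜` and for `𝒜_F`: the functions on `𝔐(𝒜)` become a subring of those on
`𝔐(𝒜_F) × 𝔸^m × 𝔾_m^m`, with the same localization at `h_w = m_w ∏ u_i`, the product being over
the `i ∉ F` with `w ⬝ a_i = 0`, and the ideal of the closure of the stratum is the trace of the
ideal of `{0} × 𝔸^m × 𝔾_m^m` (`AdaptedBasis.exists_chart`). Thus the locus `h_w ≠ 0` is an open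
subscheme both of `𝔐(𝒜)` and of `𝔐(𝒜_F) × 𝔸^{2m}`, so that the étale maps of the normal slice are
even open immersions (`exists_stratumChart`).

*Partition.* Let `p` be a prime ideal of the ring of invariants. The indices `i` for which
`z_i = w_i = 0` at `p` form a flat (`isFlat_zeroSet`). The `w` with `m_w ∉ p` are closed under
addition, without cancellation of weights at those `i` with `u_i ∈ p`; adding up sufficiently many
of them gives `w` with `h_w ∉ p` (`exists_chartFn_notMem`). So the charts cover the strata, and
smoothness follows. The closure of the stratum of `F` is all of `z_i = w_i = 0 (i ∈ F)` because
`h_0` does not divide zero on that closed subscheme (`closure_range_stratumι`).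
-/

noncomputable section

set_option linter.unusedSectionVars false

/-! ### Subalgebras, polynomial rings and monoid algebras -/

lemma Subalgebra.mem_span_of_coe_mem_span {R A : Type*} [CommRing R] [CommRing A] [Algebra R A]
    (B : Subalgebra R A) (s : Set B) (f : B)
    (h : (f : A) ∈ Submodule.span R ((fun x : B => (x : A)) '' s)) : f ∈ Submodule.span R s := by
  have : Submodule.span R ((fun x : B => (x : A)) '' s) =
      (Submodule.span R s).map B.val.toLinearMap :=
    (Submodule.map_span B.val.toLinearMap s).symm
  rw [this] at h
  obtain ⟨g, hg, hgf⟩ := h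
  rwa [← Subtype.ext hgf]

/-- A homomorphism into the range of an injective homomorphism factors through it. -/
lemma AlgHom.exists_comp_eq_of_range_le {R A B E : Type*} [CommRing R] [CommRing A] [CommRing B]
    [CommRing E] [Algebra R A] [Algebra R B] [Algebra R E] (f : A →ₐ[R] E) (g : B →ₐ[R] E)
    (hg : Function.Injective g) (h : ∀ x, f x ∈ g.range) : ∃ k : A →ₐ[R] B, ∀ x, g (k x) = f x := by
  refine ⟨(AlgEquiv.ofInjective g hg).symm.toAlgHom.comp (f.codRestrict g.range h), fun x => ?_⟩
  have := congrArg Subtype.val ((AlgEquiv.ofInjective g hg).apply_symm_apply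
    (f.codRestrict g.range h x))
  exact this

lemma AddMonoidAlgebra.mem_submodule_of_single {R P M : Type*} [CommRing R] [CommRing P]
    [Algebra R P] (N : Submodule R (AddMonoidAlgebra P M)) (g : AddMonoidAlgebra P M)
    (h : ∀ m, AddMonoidAlgebra.single m (g.coeff m) ∈ N) : g ∈ N := by
  rw [← AddMonoidAlgebra.sum_coeff_single g]
  exact Submodule.sum_mem _ fun m _ => h m

/-- The leading coefficient for the lexicographic order is a unit. -/
lemma MvPolynomial.sum_smul_X_mem_nonZeroDivisors {κ R : Type*} [Fintype κ] [CommRing R]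
    (c : κ → R) (h : ∀ j, c j = 0 ∨ IsUnit (c j)) (h' : ∃ j, IsUnit (c j)) :
    ∑ j, c j • (MvPolynomial.X j : MvPolynomial κ R) ∈ nonZeroDivisors (MvPolynomial κ R) := by
  classical
  let _ : LinearOrder κ := LinearOrder.lift' (Fintype.equivFin κ) (Fintype.equivFin κ).injective
  nontriviality R
  have hcoeff : ∀ k, (∑ j, c j • (MvPolynomial.X j : MvPolynomial κ R)).coeff k =
      ∑ j, if Finsupp.single j 1 = k then c j else 0 := by
    intro k
    simp [MvPolynomial.coeff_sum, MvPolynomial.coeff_X]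
  have hsingle : ∀ j, (∑ j, c j • (MvPolynomial.X j : MvPolynomial κ R)).coeff
      (Finsupp.single j 1) = c j := by
    intro j
    rw [hcoeff]
    simp [Finsupp.single_left_inj]
  have hu : ∀ k, (∑ j, c j • (MvPolynomial.X j : MvPolynomial κ R)).coeff k = 0 ∨
      IsUnit ((∑ j, c j • (MvPolynomial.X j : MvPolynomial κ R)).coeff k) := by
    intro k
    by_cases hk : ∃ j, Finsupp.single j 1 = k
    · obtain ⟨j, rfl⟩ := hk
      rw [hsingle]
      exact h j
    · push Not at hk
      left
      rw [hcoeff]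
      exact Finset.sum_eq_zero fun j _ => if_neg (hk j)
  have hne : ∑ j, c j • (MvPolynomial.X j : MvPolynomial κ R) ≠ 0 := by
    intro h0
    obtain ⟨j, hj⟩ := h'
    rw [← hsingle j, h0, MvPolynomial.coeff_zero] at hj
    exact not_isUnit_zero hj
  refine MonomialOrder.mem_nonZeroDivisors_of_leadingCoeff_mem_nonZeroDivisors
    (m := MonomialOrder.lex) ?_
  exact ((hu _).resolve_left (MonomialOrder.leadingCoeff_ne_zero_iff.mpr hne)).mem_nonZeroDivisors

lemma AddMonoidAlgebra.single_mem_nonZeroDivisors {P M : Type*} [CommRing P] [AddCommGroup M]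
    (m : M) (p : P) (hp : p ∈ nonZeroDivisors P) :
    AddMonoidAlgebra.single m p ∈ nonZeroDivisors (AddMonoidAlgebra P M) := by
  rw [mem_nonZeroDivisors_iff_right]
  intro f hf
  ext k
  have h := congrArg (fun g => g.coeff (k + m)) hf
  simp only [AddMonoidAlgebra.coeff_mul_single_apply, add_neg_cancel_right,
    AddMonoidAlgebra.coeff_zero, Finsupp.coe_zero, Pi.zero_apply] at h
  exact (mul_right_mem_nonZeroDivisors_eq_zero_iff hp).mp h

namespace Hypertoric

/-! ### Invariant monomials on the zero fibre of the moment map -/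

section Monomials

variable {ι : Type} [Fintype ι] [DecidableEq ι] {d : ℕ} (a : Matrix ι (Fin d) ℤ)
variable (R : Type u) [CommRing R]

/-- The class of the monomial `z^α w^β` in the coordinate ring of `μ⁻¹(0)`. -/
def monoClass (α β : ι → ℕ) : MomentRing a R :=
  (∏ i, toMomentRing a R (zVar R i) ^ α i) * ∏ i, toMomentRing a R (wVar R i) ^ β i

/-- The class of `z_i w_i` in the coordinate ring of `μ⁻¹(0)`. -/
def momentCoord (i : ι) : MomentRing a R :=
  toMomentRing a R (zVar R i) * toMomentRing a R (wVar R i)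

lemma sum_smul_momentCoord (l : ι → ℤ) (hl : l ∈ lieKernel a) :
    ∑ i, l i • momentCoord a R i = 0 := by
  have h0 : toMomentRing a R (momentComponent R l) = 0 :=
    Ideal.Quotient.eq_zero_iff_mem.mpr (Ideal.subset_span ⟨l, hl, rfl⟩)
  rw [← h0]
  simp only [momentComponent, map_sum, map_zsmul, map_mul, momentCoord]

lemma monoClass_mul (α β α' β' : ι → ℕ) :
    monoClass a R α β * monoClass a R α' β' = monoClass a R (α + α') (β + β') := by
  simp only [monoClass, Pi.add_apply, pow_add, Finset.prod_mul_distrib]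
  ring

@[simp]
lemma monoClass_zero : monoClass a R 0 0 = 1 := by simp [monoClass]

lemma monoClass_single_z (i : ι) :
    monoClass a R (Pi.single i 1) 0 = toMomentRing a R (zVar R i) := by
  simp [monoClass, Pi.single_apply, Finset.prod_ite_eq']

lemma monoClass_single_w (i : ι) :
    monoClass a R 0 (Pi.single i 1) = toMomentRing a R (wVar R i) := by
  simp [monoClass, Pi.single_apply, Finset.prod_ite_eq']

/-- A monomial is a product of powers of the `z_i w_i` and a monomial in which, for each `i`, at
most one of `z_i` and `w_i` occurs. -/
lemma monoClass_eq (α β : ι → ℕ) :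
    monoClass a R α β = (∏ i, momentCoord a R i ^ min (α i) (β i)) *
      monoClass a R (fun i => ((α i : ℤ) - β i).toNat) (fun i => (-((α i : ℤ) - β i)).toNat) := by
  simp only [monoClass, momentCoord, ← Finset.prod_mul_distrib]
  refine Finset.prod_congr rfl fun i _ => ?_
  rw [mul_pow, show ∀ x y z w : MomentRing a R, x * y * (z * w) = (x * z) * (y * w) by intros; ring,
    ← pow_add, ← pow_add]
  congr 2 <;> omega

lemma mem_span_monoClass (f : MomentRing a R) :
    f ∈ Submodule.span R (Set.range fun p : (ι → ℕ) × (ι → ℕ) => monoClass a R p.1 p.2) := by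
  obtain ⟨p, rfl⟩ := Ideal.Quotient.mkₐ_surjective R (momentIdeal a R) f
  change toMomentRing a R p ∈ _
  induction p using MvPolynomial.induction_on with
  | C r =>
    have : toMomentRing a R (MvPolynomial.C r) = r • monoClass a R 0 0 := by
      rw [monoClass_zero, ← Algebra.algebraMap_eq_smul_one]
      exact AlgHom.commutes _ r
    rw [this]
    exact Submodule.smul_mem _ _ (Submodule.subset_span ⟨(0, 0), rfl⟩)
  | add p q hp hq => rw [map_add]; exact Submodule.add_mem _ hp hq
  | mul_X p i hp =>
    rw [map_mul]
    refine Submodule.span_induction (p := fun x _ => x * toMomentRing a R (MvPolynomial.X i) ∈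
      Submodule.span R (Set.range fun p : (ι → ℕ) × (ι → ℕ) => monoClass a R p.1 p.2))
      ?_ (by simp) (fun x y _ _ hx hy => by rw [add_mul]; exact Submodule.add_mem _ hx hy)
      (fun r x _ hx => by rw [smul_mul_assoc]; exact Submodule.smul_mem _ _ hx) hp
    rintro _ ⟨⟨α, β⟩, rfl⟩
    refine Submodule.subset_span ?_
    rcases i with i | i
    · exact ⟨(α + Pi.single i 1, β + 0), by
        dsimp only; rw [← monoClass_mul, monoClass_single_z]; rfl⟩
    · exact ⟨(α + 0, β + Pi.single i 1), by
        dsimp only; rw [← monoClass_mul, monoClass_single_w]; rfl⟩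

/-- The character by which `T^k` acts on the monomial `z^α w^β`. -/
def monoWeight (α β : ι → ℕ) : CharGroup a :=
  Submodule.Quotient.mk fun i => (α i : ℤ) - β i

lemma monoWeight_eq_zero_iff (α β : ι → ℕ) :
    monoWeight a α β = 0 ↔ ∃ w : Fin d → ℤ, ∀ i, (a *ᵥ w) i = (α i : ℤ) - β i := by
  rw [monoWeight, Submodule.Quotient.mk_eq_zero, LinearMap.mem_range]
  exact exists_congr fun w => by rw [funext_iff]; rfl

lemma coaction_monoClass (α β : ι → ℕ) :
    coaction a R (monoClass a R α β) =
      AddMonoidAlgebra.single (monoWeight a α β) (monoClass a R α β) := by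
  have hz : ∀ i, coaction a R (toMomentRing a R (zVar R i)) =
      AddMonoidAlgebra.single (coordChar a i) (toMomentRing a R (zVar R i)) := fun i => by
    change coactionPoly a R (zVar R i) = _
    simp [coactionPoly, zVar]
  have hw : ∀ i, coaction a R (toMomentRing a R (wVar R i)) =
      AddMonoidAlgebra.single (-coordChar a i) (toMomentRing a R (wVar R i)) := fun i => by
    change coactionPoly a R (wVar R i) = _
    simp [coactionPoly, wVar]
  simp only [monoClass, map_mul, map_prod, map_pow, hz, hw, AddMonoidAlgebra.single_pow,
    AddMonoidAlgebra.prod_single, AddMonoidAlgebra.single_mul_single]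
  congr 1
  rw [← Finset.sum_add_distrib, monoWeight]
  have h : (fun i => (α i : ℤ) - β i) =
      ∑ i, (α i • (Pi.single i 1 : ι → ℤ) + β i • -(Pi.single i 1 : ι → ℤ)) := by
    ext j
    simp [Finset.sum_apply, Pi.single_apply, Finset.sum_add_distrib, sub_eq_add_neg]
  rw [h]
  exact (map_sum (LinearMap.range a.mulVecLin).mkQ _ _).symm

lemma monoClass_mem_invariants (α β : ι → ℕ) (h : monoWeight a α β = 0) :
    monoClass a R α β ∈ invariants a R := by
  change coaction a R _ = _
  rw [coaction_monoClass, h]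
  rfl

/-- Taking the component of weight zero preserves spans of monomials. -/
lemma mem_span_invariant_monoClass (s : Set ((ι → ℕ) × (ι → ℕ))) (f : MomentRing a R)
    (hf : f ∈ invariants a R)
    (hs : f ∈ Submodule.span R ((fun p => monoClass a R p.1 p.2) '' s)) :
    f ∈ Submodule.span R
      ((fun p => monoClass a R p.1 p.2) '' {p | p ∈ s ∧ monoWeight a p.1 p.2 = 0}) := by
  have hf' : coaction a R f = AddMonoidAlgebra.single 0 f := hf
  have key : ∀ g ∈ Submodule.span R ((fun p => monoClass a R p.1 p.2) '' s),
      (coaction a R g).coeff 0 ∈ Submodule.span R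
        ((fun p => monoClass a R p.1 p.2) '' {p | p ∈ s ∧ monoWeight a p.1 p.2 = 0}) := by
    intro g hg
    induction hg using Submodule.span_induction with
    | mem x hx =>
      obtain ⟨p, hp, rfl⟩ := hx
      by_cases h : monoWeight a p.1 p.2 = 0
      · simp only [coaction_monoClass, h, AddMonoidAlgebra.coeff_single, Finsupp.single_eq_same]
        exact Submodule.subset_span ⟨p, ⟨hp, h⟩, rfl⟩
      · simp only [coaction_monoClass, AddMonoidAlgebra.coeff_single]
        rw [Finsupp.single_eq_of_ne (Ne.symm h)]
        exact Submodule.zero_mem _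
    | zero => simp
    | add x y _ _ hx hy => rw [map_add]; exact Submodule.add_mem _ hx hy
    | smul r x _ hx => rw [map_smul]; exact Submodule.smul_mem _ _ hx
  have := key f hs
  rwa [hf', AddMonoidAlgebra.coeff_single, Finsupp.single_eq_same] at this

/-- The invariant function `z_i w_i`. -/
def invU (i : ι) : invariants a R :=
  ⟨momentCoord a R i, by
    have := monoClass_mem_invariants a R (Pi.single i 1) (Pi.single i 1)
      ((monoWeight_eq_zero_iff a _ _).mpr ⟨0, by simp⟩)
    have h2 := monoClass_mul a R (Pi.single i 1) 0 0 (Pi.single i 1)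
    rw [monoClass_single_z, monoClass_single_w, add_zero, zero_add] at h2
    rwa [momentCoord, h2]⟩

/-- The invariant monomial attached to `w ∈ (𝔱ᵈ)^*`: the product of the `z_i^{w ⬝ a_i}` with
`w ⬝ a_i ≥ 0` and the `w_i^{-w ⬝ a_i}` with `w ⬝ a_i ≤ 0`. -/
def invMono (w : Fin d → ℤ) : invariants a R :=
  ⟨monoClass a R (fun i => ((a *ᵥ w) i).toNat) (fun i => (-(a *ᵥ w) i).toNat),
    monoClass_mem_invariants a R _ _ ((monoWeight_eq_zero_iff a _ _).mpr ⟨w, fun i => by omega⟩)⟩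

lemma coe_invMono (w : Fin d → ℤ) : (invMono a R w : MomentRing a R) =
    monoClass a R (fun i => ((a *ᵥ w) i).toNat) (fun i => (-(a *ᵥ w) i).toNat) := rfl

lemma coe_invU (i : ι) : (invU a R i : MomentRing a R) = momentCoord a R i := rfl

lemma invMono_zero : invMono a R 0 = 1 :=
  Subtype.ext (by
    rw [coe_invMono]
    simp only [mulVec_zero, Pi.zero_apply, Int.toNat_zero, neg_zero]
    exact monoClass_zero a R)

lemma sum_smul_invU (l : ι → ℤ) (hl : l ∈ lieKernel a) : ∑ i, l i • invU a R i = 0 :=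
  Subtype.ext (by
    rw [ZeroMemClass.coe_zero, ← sum_smul_momentCoord a R l hl]
    push_cast
    simp [coe_invU])

lemma monoClass_eq_of_weight (α β : ι → ℕ) (w : Fin d → ℤ)
    (h : ∀ i, (a *ᵥ w) i = (α i : ℤ) - β i) :
    monoClass a R α β =
      (((∏ i, invU a R i ^ min (α i) (β i)) * invMono a R w : invariants a R) :
        MomentRing a R) := by
  rw [monoClass_eq]
  push_cast
  simp only [coe_invU, coe_invMono, h]

/-- A power of `z_i w_i` splits off if the weights of `w` and `w'` at `i` have opposite signs. -/
lemma invMono_mul (w w' : Fin d → ℤ) :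
    invMono a R w * invMono a R w' =
      (∏ i, invU a R i ^ min (((a *ᵥ w) i).toNat + ((a *ᵥ w') i).toNat)
        ((-(a *ᵥ w) i).toNat + (-(a *ᵥ w') i).toNat)) * invMono a R (w + w') := by
  refine Subtype.ext ?_
  rw [MulMemClass.coe_mul, coe_invMono, coe_invMono, monoClass_mul]
  refine monoClass_eq_of_weight a R _ _ _ fun i => ?_
  rw [mulVec_add, Pi.add_apply]
  simp only [Pi.add_apply]
  push_cast
  omega

/-- The invariant functions are spanned by the products of powers of the `z_i w_i` and an invariant
monomial. -/
lemma mem_span_invariants (f : invariants a R) :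
    f ∈ Submodule.span R (Set.range fun p : (ι → ℕ) × (Fin d → ℤ) =>
      (∏ i, invU a R i ^ p.1 i) * invMono a R p.2) := by
  refine Subalgebra.mem_span_of_coe_mem_span _ _ f ?_
  have h := mem_span_invariant_monoClass a R Set.univ f f.2
    (by rw [Set.image_univ]; exact mem_span_monoClass a R f)
  refine Submodule.span_mono ?_ h
  rintro _ ⟨⟨α, β⟩, ⟨-, hp⟩, rfl⟩
  obtain ⟨w, hw⟩ := (monoWeight_eq_zero_iff a _ _).mp hp
  exact ⟨_, ⟨(fun i => min (α i) (β i), w), rfl⟩, (monoClass_eq_of_weight a R α β w hw).symm⟩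

/-- The ideal generated by the `z_i`, `w_i` with `i ∈ S` is spanned by monomials. -/
lemma mem_span_monoClass_of_mem_span (S : Finset ι) (f : MomentRing a R)
    (hf : f ∈ Ideal.span (⋃ i ∈ S, {toMomentRing a R (zVar R i), toMomentRing a R (wVar R i)})) :
    f ∈ Submodule.span R ((fun p => monoClass a R p.1 p.2) ''
      {p : (ι → ℕ) × (ι → ℕ) | ∃ i ∈ S, 0 < p.1 i + p.2 i}) := by
  have hmul : ∀ (i : ι) (_ : i ∈ S) (α β : ι → ℕ) (_ : 0 < α i + β i) (g : MomentRing a R),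
      g * monoClass a R α β ∈ Submodule.span R ((fun p => monoClass a R p.1 p.2) ''
        {p : (ι → ℕ) × (ι → ℕ) | ∃ i ∈ S, 0 < p.1 i + p.2 i}) := by
    intro i hi α β hαβ g
    induction mem_span_monoClass a R g using Submodule.span_induction with
    | mem x hx =>
      obtain ⟨⟨α', β'⟩, rfl⟩ := hx
      refine Submodule.subset_span ⟨(α' + α, β' + β), ⟨i, hi, ?_⟩, (monoClass_mul a R _ _ _ _).symm⟩
      simp only [Pi.add_apply]
      omega
    | zero => simp
    | add x y _ _ hx hy => rw [add_mul]; exact Submodule.add_mem _ hx hy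
    | smul r x _ hx => rw [smul_mul_assoc]; exact Submodule.smul_mem _ _ hx
  induction hf using Submodule.span_induction with
  | mem x hx =>
    simp only [Set.mem_iUnion] at hx
    obtain ⟨i, hi, rfl | rfl⟩ := hx
    · have := hmul i hi (Pi.single i 1) 0 (by simp) 1
      rwa [one_mul, monoClass_single_z] at this
    · have := hmul i hi 0 (Pi.single i 1) (by simp) 1
      rwa [one_mul, monoClass_single_w] at this
  | zero => simp
  | add x y _ _ hx hy => exact Submodule.add_mem _ hx hy
  | smul r x hxs hx =>
    rw [smul_eq_mul]
    clear hxs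
    induction hx using Submodule.span_induction with
    | mem x hx =>
      obtain ⟨⟨α, β⟩, ⟨i, hi, h⟩, rfl⟩ := hx
      exact hmul i hi α β h r
    | zero => simp
    | add x y _ _ hx hy => rw [mul_add]; exact Submodule.add_mem _ hx hy
    | smul r x _ hx => rw [mul_smul_comm]; exact Submodule.smul_mem _ _ hx

lemma invU_mem_vanishingIdeal (S : Finset ι) (i : ι) (hi : i ∈ S) :
    invU a R i ∈ vanishingIdeal a R S := by
  change momentCoord a R i ∈ Ideal.span _
  refine Ideal.mul_mem_right _ _ (Ideal.subset_span ?_)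
  simp only [Set.mem_iUnion]
  exact ⟨i, hi, Or.inl rfl⟩

lemma invMono_mem_vanishingIdeal (S : Finset ι) (w : Fin d → ℤ) (i : ι) (hi : i ∈ S)
    (h : (a *ᵥ w) i ≠ 0) : invMono a R w ∈ vanishingIdeal a R S := by
  change monoClass a R _ _ ∈ Ideal.span _
  have hz : toMomentRing a R (zVar R i) ∈
      Ideal.span (⋃ i ∈ S, {toMomentRing a R (zVar R i), toMomentRing a R (wVar R i)}) :=
    Ideal.subset_span (by simp only [Set.mem_iUnion]; exact ⟨i, hi, Or.inl rfl⟩)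
  have hw : toMomentRing a R (wVar R i) ∈
      Ideal.span (⋃ i ∈ S, {toMomentRing a R (zVar R i), toMomentRing a R (wVar R i)}) :=
    Ideal.subset_span (by simp only [Set.mem_iUnion]; exact ⟨i, hi, Or.inr rfl⟩)
  rcases lt_or_gt_of_ne h with h | h
  · refine Ideal.mul_mem_left _ _ ?_
    rw [← Finset.mul_prod_erase _ _ (Finset.mem_univ i)]
    exact Ideal.mul_mem_right _ _ (Ideal.pow_mem_of_mem _ hw _ (by simp only; omega))
  · refine Ideal.mul_mem_right _ _ ?_
    rw [← Finset.mul_prod_erase _ _ (Finset.mem_univ i)]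
    exact Ideal.mul_mem_right _ _ (Ideal.pow_mem_of_mem _ hz _ (by simp only; omega))

/-- The invariant functions that vanish on `z_i = w_i = 0`, `i ∈ S`, form the ideal generated by the
`z_i w_i` with `i ∈ S` and the invariant monomials involving `z_i` or `w_i` for some `i ∈ S`. -/
lemma vanishingIdeal_eq_span (S : Finset ι) :
    vanishingIdeal a R S = Ideal.span
      ((invU a R '' S) ∪ (invMono a R '' {w | ∃ i ∈ S, (a *ᵥ w) i ≠ 0})) := by
  refine le_antisymm ?_ (Ideal.span_le.mpr ?_)
  · intro f hf
    have h := mem_span_invariant_monoClass a R _ f f.2 (mem_span_monoClass_of_mem_span a R S f hf)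
    have h2 : f ∈ Submodule.span R
        (Ideal.span ((invU a R '' S) ∪ (invMono a R '' {w | ∃ i ∈ S, (a *ᵥ w) i ≠ 0})) :
          Set (invariants a R)) := by
      refine Subalgebra.mem_span_of_coe_mem_span _ _ f (Submodule.span_mono ?_ h)
      rintro _ ⟨⟨α, β⟩, ⟨⟨i, hi, hp⟩, h0⟩, rfl⟩
      obtain ⟨w, hw⟩ := (monoWeight_eq_zero_iff a _ _).mp h0
      refine ⟨_, ?_, (monoClass_eq_of_weight a R α β w hw).symm⟩
      by_cases hwi : (a *ᵥ w) i = 0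
      · refine Ideal.mul_mem_right _ _ ?_
        rw [← Finset.mul_prod_erase _ _ (Finset.mem_univ i)]
        refine Ideal.mul_mem_right _ _ (Ideal.pow_mem_of_mem _ (Ideal.subset_span ?_) _ ?_)
        · exact Or.inl ⟨i, hi, rfl⟩
        · have := hw i
          simp only at hp this ⊢
          omega
      · exact Ideal.mul_mem_left _ _ (Ideal.subset_span (Or.inr ⟨w, ⟨i, hi, hwi⟩, rfl⟩))
    clear h hf
    induction h2 using Submodule.span_induction with
    | mem x hx => exact hx
    | zero => exact Ideal.zero_mem _
    | add x y _ _ hx hy => exact Ideal.add_mem _ hx hy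
    | smul r x _ hx => exact Submodule.smul_of_tower_mem _ r hx
  · rintro _ (⟨i, hi, rfl⟩ | ⟨w, ⟨i, hi, hw⟩, rfl⟩)
    · exact invU_mem_vanishingIdeal a R S i hi
    · exact invMono_mem_vanishingIdeal a R S w i hi hw

lemma evalOrigin_invU (i : ι) : evalOrigin a R (invU a R i) = 0 := by
  have : evalOrigin a R (invU a R i) =
      MvPolynomial.aeval (fun _ => (0 : R)) (zVar R i * wVar R i) := rfl
  rw [this]
  simp [zVar, wVar]

lemma evalOrigin_invMono (w : Fin d → ℤ) :
    evalOrigin a R (invMono a R w) = if a *ᵥ w = 0 then 1 else 0 := by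
  have : evalOrigin a R (invMono a R w) = MvPolynomial.aeval (fun _ => (0 : R))
      ((∏ i, zVar R i ^ ((a *ᵥ w) i).toNat) * ∏ i, wVar R i ^ (-(a *ᵥ w) i).toNat) := by
    change (Ideal.Quotient.liftₐ (momentIdeal a R) (MvPolynomial.aeval (fun _ => (0 : R)))
      (aeval_zero_eq_zero a R)) (monoClass a R _ _) = _
    simp only [monoClass, ← map_pow, ← map_prod, ← map_mul]
    rfl
  rw [this]
  simp only [map_mul, map_prod, map_pow, zVar, wVar, MvPolynomial.aeval_X]
  split_ifs with h
  · simp [h]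
  · obtain ⟨i, hi⟩ := Function.ne_iff.mp h
    rw [Pi.zero_apply] at hi
    rcases lt_or_gt_of_ne hi with hi | hi
    · rw [Finset.prod_eq_zero (f := fun i => (0 : R) ^ (-(a *ᵥ w) i).toNat) (Finset.mem_univ i)
        (zero_pow (by omega)), mul_zero]
    · rw [Finset.prod_eq_zero (f := fun i => (0 : R) ^ ((a *ᵥ w) i).toNat) (Finset.mem_univ i)
        (zero_pow (by omega)), zero_mul]

end Monomials

/-! ### Embedding the invariants into Laurent polynomials -/

/-- The product of the `b_i ^ (-γ_i)` over the `i` with `γ_i < 0`. -/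
def negWeight {ι P : Type*} [Fintype ι] [CommRing P] (b : ι → P) (γ : ι → ℤ) : P :=
  ∏ i, b i ^ (-γ i).toNat

section Embedding

variable {ι : Type} [Fintype ι] [DecidableEq ι] {d : ℕ} (a : Matrix ι (Fin d) ℤ)
variable (R : Type u) [CommRing R]
variable {P : Type u} [CommRing P] [Algebra R P] (b : ι → P) (σ : ι → ℤ)

/-- The map `z_i ↦ b_i^{σ_i^-} t_i`, `w_i ↦ b_i^{σ_i^+} t_i⁻¹` from functions on `T^*𝔸ⁿ` to Laurent
polynomials in the `t_i` over `P`. For signs `σ_i = ±1` it maps `z_i w_i` to `b_i`. -/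
def laurentPoly : CotRing ι R →ₐ[R] AddMonoidAlgebra P (ι → ℤ) :=
  MvPolynomial.aeval (Sum.elim
    (fun i => AddMonoidAlgebra.single (Pi.single i 1) (b i ^ (-σ i).toNat))
    (fun i => AddMonoidAlgebra.single (-Pi.single i 1) (b i ^ (σ i).toNat)))

variable (hσ : ∀ i, σ i = 1 ∨ σ i = -1) (hb : ∀ l ∈ lieKernel a, ∑ i, l i • b i = 0)

include hσ in
lemma laurentPoly_zw (i : ι) :
    laurentPoly R b σ (zVar R i * wVar R i) = AddMonoidAlgebra.single 0 (b i) := by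
  rw [map_mul]
  simp only [laurentPoly, zVar, wVar, MvPolynomial.aeval_X, Sum.elim_inl, Sum.elim_inr,
    AddMonoidAlgebra.single_mul_single, add_neg_cancel]
  rcases hσ i with h | h <;> simp [h]

include hσ hb in
lemma laurentPoly_eq_zero (p : CotRing ι R) (hp : p ∈ momentIdeal a R) :
    laurentPoly R b σ p = 0 := by
  have hle : momentIdeal a R ≤ RingHom.ker (laurentPoly R b σ) := by
    refine Ideal.span_le.mpr ?_
    rintro _ ⟨l, hl, rfl⟩
    change laurentPoly R b σ _ = 0
    simp only [momentComponent, map_sum, map_zsmul, laurentPoly_zw R b σ hσ]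
    have : ∑ i, l i • (AddMonoidAlgebra.single (0 : ι → ℤ) (b i)) =
        AddMonoidAlgebra.singleZeroRingHom (∑ i, l i • b i) := by
      simp only [map_sum, map_zsmul]
      rfl
    rw [this, hb l hl, map_zero]
  exact hle hp

/-- The map induced by `laurentPoly` on functions on `μ⁻¹(0)`. -/
def laurent : MomentRing a R →ₐ[R] AddMonoidAlgebra P (ι → ℤ) :=
  Ideal.Quotient.liftₐ (momentIdeal a R) (laurentPoly R b σ) (laurentPoly_eq_zero a R b σ hσ hb)

lemma laurent_momentCoord (i : ι) :
    laurent a R b σ hσ hb (momentCoord a R i) = AddMonoidAlgebra.single 0 (b i) :=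
  laurentPoly_zw R b σ hσ i

lemma laurent_monoClass (γ : ι → ℤ) :
    laurent a R b σ hσ hb (monoClass a R (fun i => (γ i).toNat) (fun i => (-γ i).toNat)) =
      AddMonoidAlgebra.single γ (negWeight b (σ * γ)) := by
  have hz : ∀ i, laurent a R b σ hσ hb (toMomentRing a R (zVar R i)) =
      AddMonoidAlgebra.single (Pi.single i 1) (b i ^ (-σ i).toNat) := fun i => by
    change laurentPoly R b σ (zVar R i) = _
    simp [laurentPoly, zVar]
  have hw : ∀ i, laurent a R b σ hσ hb (toMomentRing a R (wVar R i)) =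
      AddMonoidAlgebra.single (-Pi.single i 1) (b i ^ (σ i).toNat) := fun i => by
    change laurentPoly R b σ (wVar R i) = _
    simp [laurentPoly, wVar]
  simp only [monoClass, map_mul, map_prod, map_pow, hz, hw, AddMonoidAlgebra.single_pow,
    AddMonoidAlgebra.prod_single, AddMonoidAlgebra.single_mul_single]
  congr 1
  · rw [← Finset.sum_add_distrib]
    ext j
    simp [Finset.sum_apply, Pi.single_apply, Finset.sum_add_distrib]
    omega
  · rw [← Finset.prod_mul_distrib, negWeight]
    refine Finset.prod_congr rfl fun i _ => ?_
    rw [← pow_mul, ← pow_mul, ← pow_add, Pi.mul_apply]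
    congr 1
    rcases hσ i with h | h <;> simp [h]

/-- Every function on `μ⁻¹(0)` is a combination of monomials, at most one of `z_i` and `w_i`
occurring in each, with polynomials in the `z_i w_i` as coefficients. -/
lemma exists_eq_sum_monoClass (f : MomentRing a R) :
    ∃ p : (ι → ℤ) →₀ MvPolynomial ι R, f = p.sum fun γ q =>
      MvPolynomial.aeval (momentCoord a R) q *
        monoClass a R (fun i => (γ i).toNat) (fun i => (-γ i).toNat) := by
  let N : ((ι → ℤ) →₀ MvPolynomial ι R) →ₗ[R] MomentRing a R :=
    Finsupp.lsum R fun γ =>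
      (LinearMap.mulRight R (monoClass a R (fun i => (γ i).toNat) (fun i => (-γ i).toNat))).comp
        (MvPolynomial.aeval (momentCoord a R)).toLinearMap
  have hN : f ∈ LinearMap.range N := by
    have h := mem_span_monoClass a R f
    have hle : Submodule.span R (Set.range fun p : (ι → ℕ) × (ι → ℕ) => monoClass a R p.1 p.2) ≤
        LinearMap.range N := by
      refine Submodule.span_le.mpr ?_
      rintro _ ⟨⟨α, β⟩, rfl⟩
      refine ⟨Finsupp.single (fun i => (α i : ℤ) - β i)
        (∏ i, MvPolynomial.X i ^ min (α i) (β i)), ?_⟩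
      rw [Finsupp.lsum_single]
      simp only [LinearMap.comp_apply, AlgHom.toLinearMap_apply, LinearMap.mulRight_apply,
        map_prod, map_pow, MvPolynomial.aeval_X]
      exact (monoClass_eq a R α β).symm
    exact hle h
  obtain ⟨p, rfl⟩ := hN
  exact ⟨p, rfl⟩

lemma laurent_aeval (q : MvPolynomial ι R) :
    laurent a R b σ hσ hb (MvPolynomial.aeval (momentCoord a R) q) =
      AddMonoidAlgebra.single 0 (MvPolynomial.aeval b q) := by
  have : (laurent a R b σ hσ hb).comp (MvPolynomial.aeval (momentCoord a R)) =
      (AddMonoidAlgebra.singleZeroAlgHom (R := R) (A := P) (M := ι → ℤ)).comp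
        (MvPolynomial.aeval b) := by
    refine MvPolynomial.algHom_ext fun i => ?_
    simp only [AlgHom.comp_apply, MvPolynomial.aeval_X, laurent_momentCoord]
    rfl
  exact DFunLike.congr_fun this q

/-- Injectivity is tested on each Laurent exponent separately, where it says that the `b_i` satisfy
no more relations than the `z_i w_i`. -/
lemma laurent_injective (hreg : ∀ i, b i ∈ nonZeroDivisors P)
    (hker : ∀ q : MvPolynomial ι R, MvPolynomial.aeval b q = 0 →
      MvPolynomial.aeval (momentCoord a R) q = 0) :
    Function.Injective (laurent a R b σ hσ hb) := by
  rw [injective_iff_map_eq_zero]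
  intro f hf
  obtain ⟨p, rfl⟩ := exists_eq_sum_monoClass a R f
  refine Finset.sum_eq_zero fun γ _ => ?_
  dsimp only
  rw [hker _ ?_, zero_mul]
  have h : negWeight b (σ * γ) ∈ nonZeroDivisors P :=
    Submonoid.prod_mem _ fun i _ => Submonoid.pow_mem _ (hreg i) _
  refine (mul_right_mem_nonZeroDivisors_eq_zero_iff h).mp ?_
  have h2 := congrArg (fun x => AddMonoidAlgebra.coeff x γ) hf
  simp only [Finsupp.sum, map_sum, map_mul, laurent_aeval, laurent_monoClass,
    AddMonoidAlgebra.single_mul_single, zero_add, AddMonoidAlgebra.coeff_sum,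
    AddMonoidAlgebra.coeff_single, Finsupp.finsetSum_apply, AddMonoidAlgebra.coeff_zero,
    Finsupp.coe_zero, Pi.zero_apply, Finsupp.single_apply, Finset.sum_ite_eq'] at h2
  split_ifs at h2
  exact h2

variable {Λ : Type} [AddCommGroup Λ] (χ : Λ →+ (ι → ℤ))

include hσ hb in
/-- The ring of invariant functions on `μ⁻¹(0)` as a ring of Laurent polynomials. Let `P` be a model
of the ring of polynomials in the `z_i w_i` modulo the moment map equations, `b_i` the image of
`z_i w_i`, and let `χ : Λ → ℤⁿ` be injective with the same image as `(𝔱ᵈ)^*`. The invariant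
functions are identified with the Laurent polynomials over `P` with exponents in `Λ` whose
coefficient at `v` is divisible by the product of the powers of `b_i` with exponents
`(σ_i χ_i(v))^-`. -/
theorem exists_invariants_embedding (hreg : ∀ i, b i ∈ nonZeroDivisors P)
    (hker : ∀ q : MvPolynomial ι R, MvPolynomial.aeval b q = 0 →
      MvPolynomial.aeval (momentCoord a R) q = 0)
    (hsurj : Function.Surjective (MvPolynomial.aeval b : MvPolynomial ι R →ₐ[R] P))
    (hχ : Function.Injective χ) (hχ1 : ∀ w, ∃ v, χ v = a *ᵥ w) (hχ2 : ∀ v, ∃ w, χ v = a *ᵥ w) :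
    ∃ Φ : invariants a R →ₐ[R] AddMonoidAlgebra P Λ, Function.Injective Φ ∧
      (∀ q : MvPolynomial ι R, Φ (MvPolynomial.aeval (invU a R) q) =
        AddMonoidAlgebra.single 0 (MvPolynomial.aeval b q)) ∧
      (∀ w v, χ v = a *ᵥ w → Φ (invMono a R w) =
        AddMonoidAlgebra.single v (negWeight b (σ * χ v))) ∧
      (∀ g, (∃ f, Φ f = g) ↔ ∀ v, negWeight b (σ * χ v) ∣ g.coeff v) := by
  let D : AddMonoidAlgebra P Λ →ₐ[R] AddMonoidAlgebra P (ι → ℤ) :=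
    AddMonoidAlgebra.mapDomainAlgHom R P χ
  have hDs : ∀ v p, D (AddMonoidAlgebra.single v p) = AddMonoidAlgebra.single (χ v) p :=
    fun v p => AddMonoidAlgebra.mapDomain_single
  have hDinj : Function.Injective D := AddMonoidAlgebra.mapDomain_injective hχ
  let Θ := (laurent a R b σ hσ hb).comp (invariants a R).val
  have hΘinj : Function.Injective Θ :=
    (laurent_injective a R b σ hσ hb hreg hker).comp Subtype.val_injective
  have hΘq : ∀ q : MvPolynomial ι R, Θ (MvPolynomial.aeval (invU a R) q) =
      D (AddMonoidAlgebra.single 0 (MvPolynomial.aeval b q)) := by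
    intro q
    rw [hDs, map_zero, ← laurent_aeval a R b σ hσ hb]
    refine congrArg (laurent a R b σ hσ hb) ?_
    exact MvPolynomial.comp_aeval_apply (invU a R) (invariants a R).val q
  have hΘm : ∀ w v, χ v = a *ᵥ w → Θ (invMono a R w) =
      D (AddMonoidAlgebra.single v (negWeight b (σ * χ v))) := by
    intro w v h
    rw [hDs, h]
    exact laurent_monoClass a R b σ hσ hb _
  have hΘ : ∀ (κ : ι → ℕ) w v, χ v = a *ᵥ w →
      Θ ((∏ i, invU a R i ^ κ i) * invMono a R w) =
      D (AddMonoidAlgebra.single v ((∏ i, b i ^ κ i) * negWeight b (σ * χ v))) := by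
    intro κ w v h
    have h1 : (∏ i, invU a R i ^ κ i) =
        MvPolynomial.aeval (invU a R) (∏ i, MvPolynomial.X i ^ κ i : MvPolynomial ι R) := by
      simp
    rw [map_mul, h1, hΘq, hΘm w v h, ← map_mul, AddMonoidAlgebra.single_mul_single, zero_add]
    simp
  have hrange : ∀ f, Θ f ∈ D.range := by
    intro f
    have h := mem_span_invariants a R f
    induction h using Submodule.span_induction with
    | mem x hx =>
      obtain ⟨⟨κ, w⟩, rfl⟩ := hx
      obtain ⟨v, hv⟩ := hχ1 w
      exact ⟨_, (hΘ κ w v hv).symm⟩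
    | zero => rw [map_zero]; exact Subalgebra.zero_mem _
    | add x y _ _ hx hy => rw [map_add]; exact Subalgebra.add_mem _ hx hy
    | smul r x _ hx => rw [map_smul]; exact Subalgebra.smul_mem _ hx r
  obtain ⟨Φ, hΦ⟩ := AlgHom.exists_comp_eq_of_range_le Θ D hDinj hrange
  have hq : ∀ q : MvPolynomial ι R, Φ (MvPolynomial.aeval (invU a R) q) =
      AddMonoidAlgebra.single 0 (MvPolynomial.aeval b q) := fun q => hDinj (by rw [hΦ, hΘq])
  have hm : ∀ w v, χ v = a *ᵥ w → Φ (invMono a R w) =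
      AddMonoidAlgebra.single v (negWeight b (σ * χ v)) :=
    fun w v h => hDinj (by rw [hΦ, hΘm w v h])
  refine ⟨Φ, fun x y h => hΘinj (by rw [← hΦ, ← hΦ, h]), hq, hm, fun g => ⟨?_, ?_⟩⟩
  · rintro ⟨f, rfl⟩ v
    have h := mem_span_invariants a R f
    induction h using Submodule.span_induction with
    | mem x hx =>
      classical
      obtain ⟨⟨κ, w⟩, rfl⟩ := hx
      obtain ⟨v', hv⟩ := hχ1 w
      have : Φ ((∏ i, invU a R i ^ κ i) * invMono a R w) = _ :=
        hDinj ((hΦ _).trans (hΘ κ w v' hv))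
      dsimp only
      rw [this, AddMonoidAlgebra.coeff_single, Finsupp.single_apply]
      split_ifs with h
      · rw [← h]; exact dvd_mul_left _ _
      · exact dvd_zero _
    | zero => simp
    | add x y _ _ hx hy => rw [map_add]; exact dvd_add hx hy
    | smul r x _ hx =>
      rw [map_smul, AddMonoidAlgebra.coeff_smul_apply]
      exact dvd_smul_of_dvd r hx
  · intro hg
    change g ∈ LinearMap.range Φ.toLinearMap
    refine AddMonoidAlgebra.mem_submodule_of_single _ g fun v => ?_
    obtain ⟨p, hp⟩ := hg v
    obtain ⟨q, rfl⟩ := hsurj p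
    obtain ⟨w, hw⟩ := hχ2 v
    refine ⟨MvPolynomial.aeval (invU a R) q * invMono a R w, ?_⟩
    rw [AlgHom.toLinearMap_apply, map_mul, hq, hm w v hw, AddMonoidAlgebra.single_mul_single,
      zero_add, hp, mul_comm]

end Embedding

/-! ### Bases adapted to a subset of the arrangement -/

section RationalSpan

variable {ι : Type} {d : ℕ}

/-- Integer vectors as rational vectors. -/
def toRat (d : ℕ) : (Fin d → ℤ) →ₗ[ℤ] (Fin d → ℚ) :=
  (Algebra.linearMap ℤ ℚ).compLeft (Fin d)

@[simp]
lemma toRat_apply (v : Fin d → ℤ) (j : Fin d) : toRat d v j = (v j : ℚ) := rfl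

lemma toRat_injective : Function.Injective (toRat d) := fun v w h => by
  ext j
  have := congrFun h j
  simpa using this

lemma linearIndependent_toRat_iff {κ : Type} (v : κ → Fin d → ℤ) :
    LinearIndependent ℤ v ↔ LinearIndependent ℚ (toRat d ∘ v) := by
  rw [← LinearIndependent.iff_fractionRing ℤ ℚ]
  exact ⟨fun h => h.map' _ (LinearMap.ker_eq_bot.mpr toRat_injective),
    fun h => LinearIndependent.of_comp _ h⟩

lemma finrank_span_le_of_subset_span_rat (a : ι → Fin d → ℤ) {κ : Type} [Fintype κ]
    (b : κ → Fin d → ℚ) (h : ∀ i, toRat d (a i) ∈ Submodule.span ℚ (Set.range b)) :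
    Module.finrank ℤ (Submodule.span ℤ (Set.range a)) ≤ Fintype.card κ := by
  obtain ⟨f, hf⟩ := exists_linearIndependent_of_le_finrank
    (le_refl (Module.finrank ℤ (Submodule.span ℤ (Set.range a))))
  have h1 : LinearIndependent ℤ (fun i => (f i : Fin d → ℤ)) :=
    hf.map' (Submodule.subtype _) (Submodule.ker_subtype _)
  have h2 := (linearIndependent_toRat_iff _).mp h1
  have h3 : ∀ i, toRat d (f i : Fin d → ℤ) ∈ Submodule.span ℚ (Set.range b) := by
    intro i
    have hle : Submodule.span ℤ (Set.range a) ≤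
        ((Submodule.span ℚ (Set.range b)).restrictScalars ℤ).comap (toRat d) :=
      Submodule.span_le.mpr (by rintro _ ⟨j, rfl⟩; exact h j)
    exact hle (f i).2
  have h4 : LinearIndependent ℚ
      (fun i => (⟨_, h3 i⟩ : Submodule.span ℚ (Set.range b))) :=
    LinearIndependent.of_comp (Submodule.subtype _) h2
  have h5 := h4.fintype_card_le_finrank
  rw [Fintype.card_fin] at h5
  exact h5.trans (finrank_range_le_card b)

lemma card_le_finrank_span (a : ι → Fin d → ℤ) {κ : Type} [Fintype κ] (t : κ → ι)
    (h : LinearIndependent ℚ (fun j => toRat d (a (t j)))) :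
    Fintype.card κ ≤ Module.finrank ℤ (Submodule.span ℤ (Set.range a)) := by
  have h1 : LinearIndependent ℤ (fun j => a (t j)) := (linearIndependent_toRat_iff _).mpr h
  have h2 : LinearIndependent ℤ (fun j => (⟨a (t j), Submodule.subset_span ⟨t j, rfl⟩⟩ :
      Submodule.span ℤ (Set.range a))) := LinearIndependent.of_comp (Submodule.subtype _) h1
  exact h2.fintype_card_le_finrank

lemma dotProduct_eq_zero_of_mem_span_rat {κ : Type} (b : κ → Fin d → ℤ) (x v : Fin d → ℤ)
    (hx : toRat d x ∈ Submodule.span ℚ (Set.range fun j => toRat d (b j)))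
    (h : ∀ j, b j ⬝ᵥ v = 0) : x ⬝ᵥ v = 0 := by
  have key : ∀ y : Fin d → ℤ, toRat d y ⬝ᵥ toRat d v = ((y ⬝ᵥ v : ℤ) : ℚ) := by
    intro y
    simp [dotProduct]
  have h2 : ∀ z ∈ Submodule.span ℚ (Set.range fun j => toRat d (b j)), z ⬝ᵥ toRat d v = 0 := by
    intro z hz
    induction hz using Submodule.span_induction with
    | mem z hz => obtain ⟨j, rfl⟩ := hz; rw [key, h j, Int.cast_zero]
    | zero => exact zero_dotProduct _
    | add z w _ _ hz hw => rw [add_dotProduct, hz, hw, add_zero]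
    | smul q z _ hz => rw [smul_dotProduct, hz, smul_zero]
  have := h2 _ hx
  rw [key] at this
  exact_mod_cast this

end RationalSpan

/-- A maximal linearly independent family `a_{τ j}` of the vectors `a_i`, the first `r` members of
which form a maximal linearly independent family among the `a_i` with `i ∈ F`. -/
structure AdaptedBasis {n d : ℕ} (a : Matrix (Fin n) (Fin d) ℤ) (F : Finset (Fin n)) where
  /-- The rank of `F`. -/
  r : ℕ
  /-- The corank of `F`. -/
  m : ℕ
  /-- The numbering of the chosen vectors. -/
  e : Fin r ⊕ Fin m ≃ Fin d
  /-- The indices of the chosen vectors. -/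
  τ : Fin r ⊕ Fin m → Fin n
  τ_mem : ∀ j, τ (Sum.inl j) ∈ F
  det_ne : (a.submatrix τ e).det ≠ 0
  dot_eq_zero : ∀ i ∈ F, ∀ v, (∀ j, a (τ (Sum.inl j)) ⬝ᵥ v = 0) → a i ⬝ᵥ v = 0
  rank_eq : rank (localization a F) = r

/-- A basis over `ℚ` of the span of the `a_i` with `i ∈ F`, chosen among them and then extended to a
basis of `ℚᵈ` by further `a_i`. -/
theorem exists_adaptedBasis {n d : ℕ} (a : Matrix (Fin n) (Fin d) ℤ) (hrank : rank a = d)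
    (F : Finset (Fin n)) : Nonempty (AdaptedBasis a F) := by
  classical
  obtain ⟨b₁, hb₁F, -, hspan₁, hli₁⟩ := exists_linearIndepOn_extension (K := ℚ)
    (v := fun i => toRat d (a i)) (linearIndepOn_empty ℚ _) (Set.empty_subset (F : Set (Fin n)))
  obtain ⟨b₂, -, hb₁₂, hspan₂, hli₂⟩ := exists_linearIndepOn_extension hli₁ (Set.subset_univ b₁)
  let e₁ : Fin (Fintype.card b₁) ≃ b₁ := (Fintype.equivFin _).symm
  let e₂ : Fin (Fintype.card ↑(b₂ \ b₁)) ≃ ↑(b₂ \ b₁) := (Fintype.equivFin _).symm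
  let e' : Fin (Fintype.card b₁) ⊕ Fin (Fintype.card ↑(b₂ \ b₁)) ≃ b₂ :=
    (Equiv.sumCongr e₁ e₂).trans (Equiv.Set.sumDiffSubset hb₁₂)
  let τ : Fin (Fintype.card b₁) ⊕ Fin (Fintype.card ↑(b₂ \ b₁)) → Fin n := fun j => e' j
  have hτl : ∀ j, τ (Sum.inl j) = e₁ j := fun j => rfl
  have hli : LinearIndependent ℚ (fun j => toRat d (a (τ j))) := hli₂.comp e' e'.injective
  have hcard : Fintype.card (Fin (Fintype.card b₁) ⊕ Fin (Fintype.card ↑(b₂ \ b₁))) = d := by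
    refine le_antisymm ?_ ?_
    · simpa using hli.fintype_card_le_finrank
    · conv_lhs => rw [← hrank]
      refine finrank_span_le_of_subset_span_rat a (fun j => toRat d (a (τ j))) fun i => ?_
      have := hspan₂ ⟨i, Set.mem_univ i, rfl⟩
      refine Submodule.span_mono ?_ this
      rintro _ ⟨x, hx, rfl⟩
      exact ⟨e'.symm ⟨x, hx⟩, by simp [τ]⟩
  let e := Fintype.equivFinOfCardEq hcard
  have hspanF : ∀ i ∈ F, toRat d (a i) ∈
      Submodule.span ℚ (Set.range fun j => toRat d (a (τ (Sum.inl j)))) := by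
    intro i hi
    refine Submodule.span_mono ?_ (hspan₁ ⟨i, hi, rfl⟩)
    rintro _ ⟨x, hx, rfl⟩
    exact ⟨e₁.symm ⟨x, hx⟩, by simp [hτl]⟩
  refine ⟨⟨_, _, e, τ, fun j => ?_, ?_, ?_, ?_⟩⟩
  · rw [hτl]
    exact hb₁F (e₁ j).2
  · intro h0
    have h1 : LinearIndependent ℚ
        ((a.submatrix τ id).map (fun x : ℤ => (x : ℚ)) |>.submatrix id e).row := by
      refine (hli.map' (LinearEquiv.funCongrLeft ℚ ℚ e).toLinearMap (LinearEquiv.ker _))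
    have h2 := (Matrix.isUnit_iff_isUnit_det _).mp (Matrix.linearIndependent_rows_iff_isUnit.mp h1)
    have h3 : ((a.submatrix τ id).map (fun x : ℤ => (x : ℚ)) |>.submatrix id e).det =
        (((a.submatrix τ e).det : ℤ) : ℚ) := by
      rw [Int.cast_det]
      rfl
    rw [h3, h0] at h2
    simp at h2
  · intro i hi v hv
    exact dotProduct_eq_zero_of_mem_span_rat (fun j => a (τ (Sum.inl j))) _ v (hspanF i hi) hv
  · refine le_antisymm ?_ ?_
    · have := finrank_span_le_of_subset_span_rat (localization a F)
        (fun j => toRat d (a (τ (Sum.inl j)))) fun i => hspanF i i.2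
      rwa [Fintype.card_fin] at this
    · have := card_le_finrank_span (localization a F)
        (fun j => (⟨τ (Sum.inl j), by rw [hτl]; exact hb₁F (e₁ j).2⟩ : F))
        (hli.comp Sum.inl Sum.inl_injective)
      rwa [Fintype.card_fin] at this

namespace AdaptedBasis

variable {n d : ℕ} {a : Matrix (Fin n) (Fin d) ℤ} {F : Finset (Fin n)} (A : AdaptedBasis a F)

/-- The square matrix with rows `a_{τ j}`. -/
def mat : Matrix (Fin A.r ⊕ Fin A.m) (Fin A.r ⊕ Fin A.m) ℤ := a.submatrix A.τ A.e

lemma r_add_m : A.r + A.m = d := by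
  have := Fintype.card_congr A.e
  simpa using this

/-- The `j`-th column of the adjugate of `mat`: a vector orthogonal to all `a_{τ k}`, `k ≠ j`. -/
def dualVec (j : Fin A.r ⊕ Fin A.m) : Fin d → ℤ := fun x => A.mat.adjugate (A.e.symm x) j

/-- The coefficient of `a_{τ j}` in the expansion of `det mat • a_i`. -/
def coef (i : Fin n) (j : Fin A.r ⊕ Fin A.m) : ℤ := a i ⬝ᵥ A.dualVec j

lemma coef_eq (i : Fin n) (j : Fin A.r ⊕ Fin A.m) :
    A.coef i j = ((fun k => a i (A.e k)) ᵥ* A.mat.adjugate) j := by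
  rw [coef, dotProduct, vecMul, dotProduct, ← A.e.sum_comp]
  simp [dualVec]

/-- Cramer's rule: the coefficients are again maximal minors. -/
lemma coef_eq_det (i : Fin n) (j : Fin A.r ⊕ Fin A.m) :
    A.coef i j = (a.submatrix (Function.update A.τ j i) A.e).det := by
  have : (a.submatrix (Function.update A.τ j i) A.e) =
      A.mat.updateRow j (fun k => a i (A.e k)) := by
    ext x y
    by_cases h : x = j
    · subst h; simp
    · simp [h, mat]
  rw [this, ← cramer_transpose_apply, cramer_eq_adjugate_mulVec, ← adjugate_transpose,
    mulVec_transpose, coef_eq]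

lemma coef_τ (k j : Fin A.r ⊕ Fin A.m) :
    A.coef (A.τ k) j = if k = j then A.mat.det else 0 := by
  have h := congrFun (congrFun (mul_adjugate A.mat) k) j
  simp only [Matrix.smul_apply, one_apply, smul_eq_mul, mul_ite, mul_one, mul_zero] at h
  rw [← h, coef_eq, vecMul, mul_apply]
  rfl

lemma det_smul_eq (i : Fin n) : A.mat.det • a i = ∑ j, A.coef i j • a (A.τ j) := by
  have h : ((fun k => a i (A.e k)) ᵥ* A.mat.adjugate) ᵥ* A.mat =
      A.mat.det • (fun k => a i (A.e k)) := by
    rw [vecMul_vecMul, adjugate_mul, vecMul_smul, vecMul_one]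
  ext x
  have hx := congrFun h (A.e.symm x)
  simp only [vecMul, dotProduct, Pi.smul_apply, Equiv.apply_symm_apply] at hx
  rw [Pi.smul_apply, ← hx]
  simp only [Finset.sum_apply, Pi.smul_apply, smul_eq_mul, coef_eq, mat, submatrix_apply,
    Equiv.apply_symm_apply]
  rfl

/-- The coefficients of `a_i` along the second part of the family vanish if `H_F ⊆ H_i`. -/
lemma coef_inr_eq_zero (i : Fin n) (hi : hyperplaneInter a F ⊆ hyperplane a i) (j : Fin A.m) :
    A.coef i (Sum.inr j) = 0 := by
  refine hi ?_
  simp only [hyperplaneInter, Set.mem_iInter, hyperplane, Set.mem_ofPred_eq]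
  intro k hk
  refine A.dot_eq_zero k hk _ fun j' => ?_
  change A.coef _ _ = 0
  rw [coef_τ, if_neg (by simp)]

lemma coef_inr_eq_zero_of_mem (i : Fin n) (hi : i ∈ F) (j : Fin A.m) :
    A.coef i (Sum.inr j) = 0 :=
  A.coef_inr_eq_zero i (Set.iInter₂_subset i hi) j

lemma exists_coef_inr_ne_zero (hF : IsFlat a F) (i : Fin n) (hi : i ∉ F) :
    ∃ j, A.coef i (Sum.inr j) ≠ 0 := by
  by_contra! h
  refine hi ((hF i).mpr fun v hv => ?_)
  have h1 : (A.mat.det • a i) ⬝ᵥ v = 0 := by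
    rw [A.det_smul_eq, Fintype.sum_sum_type]
    simp only [h, zero_smul, Finset.sum_const_zero, add_zero, sum_dotProduct, smul_dotProduct]
    refine Finset.sum_eq_zero fun j _ => ?_
    simp only [hyperplaneInter, Set.mem_iInter, hyperplane, Set.mem_ofPred_eq] at hv
    rw [hv _ (A.τ_mem j), smul_zero]
  rw [smul_dotProduct, smul_eq_mul] at h1
  exact (mul_eq_zero.mp h1).resolve_left A.det_ne

lemma exists_coef_ne_zero (i : Fin n) (hi : a i ≠ 0) : ∃ j, A.coef i j ≠ 0 := by
  by_contra! h
  have h1 := A.det_smul_eq i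
  simp only [h, zero_smul, Finset.sum_const_zero] at h1
  exact hi ((smul_eq_zero.mp h1).resolve_left A.det_ne)

include A in
lemma mulVec_injective : Function.Injective fun w : Fin d → ℤ => a *ᵥ w := by
  intro w w' h
  have h0 : A.mat *ᵥ (fun k => w (A.e k) - w' (A.e k)) = 0 := by
    ext j
    have h1 := congrFun h (A.τ j)
    simp only [mulVec, dotProduct] at h1
    rw [← A.e.sum_comp, ← A.e.sum_comp (fun x => a (A.τ j) x * w' x)] at h1
    simp only [mulVec, dotProduct, mat, submatrix_apply, mul_sub, Finset.sum_sub_distrib, h1,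
      sub_self, Pi.zero_apply]
  have h2 := eq_zero_of_mulVec_eq_zero A.det_ne h0
  ext x
  have := congrFun h2 (A.e.symm x)
  simp only [Equiv.apply_symm_apply, Pi.zero_apply] at this
  omega

/-- The lattice orthogonal to the `a_i` with `i ∈ F` has rank `m`. -/
lemma finrank_ker : Module.finrank ℤ (LinearMap.ker (localization a F).mulVecLin) = A.m := by
  have h1 : Module.finrank ℤ (LinearMap.ker (localization a F).mulVecLin) ≤ A.m := by
    let f : LinearMap.ker (localization a F).mulVecLin →ₗ[ℤ] (Fin A.m → ℤ) :=
      ((LinearMap.funLeft ℤ ℤ (fun j : Fin A.m => A.τ (Sum.inr j))).comp a.mulVecLin).comp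
        (Submodule.subtype _)
    have hf : Function.Injective f := by
      rw [injective_iff_map_eq_zero]
      rintro ⟨w, hw⟩ h0
      refine Subtype.ext (A.mulVec_injective (funext fun i => ?_))
      change (a *ᵥ w) i = (a *ᵥ 0) i
      have hτ : ∀ j, a (A.τ j) ⬝ᵥ w = 0 := by
        rintro (j | j)
        · exact congrFun (LinearMap.mem_ker.mp hw) ⟨_, A.τ_mem j⟩
        · exact congrFun h0 j
      rw [mulVec_zero, Pi.zero_apply, mulVec]
      have h2 : (A.mat.det • a i) ⬝ᵥ w = 0 := by
        rw [A.det_smul_eq, sum_dotProduct]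
        exact Finset.sum_eq_zero fun j _ => by rw [smul_dotProduct, hτ, smul_zero]
      rw [smul_dotProduct, smul_eq_mul] at h2
      exact (mul_eq_zero.mp h2).resolve_left A.det_ne
    simpa using LinearMap.finrank_le_finrank_of_injective hf
  have h2 : Module.finrank ℤ (LinearMap.range (localization a F).mulVecLin) ≤ A.r := by
    let f : LinearMap.range (localization a F).mulVecLin →ₗ[ℤ] (Fin A.r → ℤ) :=
      (LinearMap.funLeft ℤ ℤ (fun j : Fin A.r => (⟨A.τ (Sum.inl j), A.τ_mem j⟩ : F))).comp
        (Submodule.subtype _)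
    have hf : Function.Injective f := by
      rw [injective_iff_map_eq_zero]
      rintro ⟨_, w, rfl⟩ h0
      refine Subtype.ext (funext fun i => ?_)
      exact A.dot_eq_zero i i.2 w fun j => congrFun h0 j
    simpa using LinearMap.finrank_le_finrank_of_injective hf
  have h3 := Submodule.finrank_quotient_add_finrank (LinearMap.ker (localization a F).mulVecLin)
  rw [LinearEquiv.finrank_eq (LinearMap.quotKerEquivRange _)] at h3
  have h4 := A.r_add_m
  simp only [Module.finrank_fintype_fun_eq_card, Fintype.card_fin] at h3
  omega

/-- A splitting of `(𝔱ᵈ)^*` into the lattice `(𝔱^r)^*` attached to the localization at `F` and the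
lattice orthogonal to the `a_i` with `i ∈ F`, expressed by the embedding of both into `ℤⁿ`. -/
theorem exists_splitting :
    ∃ χ : (LinearMap.range (localization a F).mulVecLin × (Fin A.m → ℤ)) →+ (Fin n → ℤ),
      Function.Injective χ ∧ (∀ w, ∃ v, χ v = a *ᵥ w) ∧ (∀ v, ∃ w, χ v = a *ᵥ w) ∧
      ∀ v (i : F), χ v i = (v.1 : F → ℤ) i := by
  let f := (localization a F).mulVecLin
  obtain ⟨s, hs⟩ := f.rangeRestrict.exists_rightInverse_of_surjective f.range_rangeRestrict
  have hs' : ∀ y, f (s y) = y := fun y => congrArg Subtype.val (LinearMap.congr_fun hs y)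
  let E : LinearMap.ker f ≃ₗ[ℤ] (Fin A.m → ℤ) :=
    (Module.finBasisOfFinrankEq ℤ _ A.finrank_ker).equivFun
  let T : (LinearMap.range f × (Fin A.m → ℤ)) →ₗ[ℤ] (Fin d → ℤ) :=
    s.coprod ((Submodule.subtype _).comp E.symm.toLinearMap)
  have hT : ∀ v, T v = s v.1 + (E.symm v.2 : Fin d → ℤ) := fun v => rfl
  have hfT : ∀ v, f (T v) = v.1 := fun v => by
    rw [hT, map_add, hs', LinearMap.mem_ker.mp (E.symm v.2).2, add_zero]
  refine ⟨(a.mulVecLin.comp T).toAddMonoidHom, ?_, fun w => ?_, fun v => ⟨T v, rfl⟩, fun v i => ?_⟩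
  · rw [injective_iff_map_eq_zero]
    rintro v h
    have h1 : T v = 0 := A.mulVec_injective (h.trans (mulVec_zero a).symm)
    have h2 : v.1 = 0 := Subtype.ext (by rw [← hfT v, h1, map_zero]; rfl)
    have h3 : v.2 = 0 := by
      have := hT v
      rw [h1, h2, map_zero, zero_add] at this
      exact E.symm.map_eq_zero_iff.mp (Subtype.ext this.symm)
    exact Prod.ext h2 h3
  · have hk : w - s (f.rangeRestrict w) ∈ LinearMap.ker f := by
      rw [LinearMap.mem_ker, map_sub, hs']
      exact sub_self _
    refine ⟨(f.rangeRestrict w, E ⟨_, hk⟩), ?_⟩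
    change a *ᵥ T _ = _
    rw [hT, LinearEquiv.symm_apply_apply]
    simp
  · exact congrFun (hfT v) i

end AdaptedBasis

/-! ### Functions on a product with an affine space and a torus -/

/-- Functions on `X × 𝔸^m × 𝔾_m^m`, for an affine scheme `X` with coordinate ring `S`. -/
abbrev TorusRing (m : ℕ) (S : Type u) [CommRing S] : Type u :=
  AddMonoidAlgebra (MvPolynomial (Fin m) S) (Fin m → ℤ)

section TorusEmbedding

variable {R : Type u} [CommRing R] {P : Type u} [CommRing P] [Algebra R P]
variable {Λ : Type} [AddCommGroup Λ] {S : Type u} [CommRing S] [Algebra R S] (m : ℕ)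
variable (Φ : S →ₐ[R] AddMonoidAlgebra P Λ)

/-- The inclusion of Laurent polynomials over `P` with exponents in `Λ` into those over
`P[x_1, …, x_m]` with exponents in `Λ × ℤ^m`. -/
def laurentIncl (R : Type u) [CommRing R] (P : Type u) [CommRing P] [Algebra R P] (Λ : Type)
    [AddCommGroup Λ] (m : ℕ) : AddMonoidAlgebra P Λ →ₐ[R]
      AddMonoidAlgebra (MvPolynomial (Fin m) P) (Λ × (Fin m → ℤ)) :=
  AddMonoidAlgebra.liftNCAlgHom
    ((AddMonoidAlgebra.singleZeroAlgHom (R := R)).comp (Algebra.algHom R P _))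
    ((AddMonoidAlgebra.of _ _).comp (AddMonoidHom.inl Λ (Fin m → ℤ)).toMultiplicative)
    (fun _ _ => Commute.all _ _)

lemma laurentIncl_single (v : Λ) (p : P) :
    laurentIncl R P Λ m (AddMonoidAlgebra.single v p) =
      AddMonoidAlgebra.single (v, 0) (MvPolynomial.C p) := by
  rw [laurentIncl, AddMonoidAlgebra.coe_liftNCAlgHom, AddMonoidAlgebra.liftNC_single]
  simp [AddMonoidAlgebra.single_mul_single]
  rfl

/-- The extension of a map `S → P[Λ]` to `S[x_1, …, x_m, y_1^±, …, y_m^±]`. -/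
def torusMap : TorusRing m S →ₐ[R]
    AddMonoidAlgebra (MvPolynomial (Fin m) P) (Λ × (Fin m → ℤ)) :=
  AddMonoidAlgebra.liftNCAlgHom
    (MvPolynomial.aevalTower ((laurentIncl R P Λ m).comp Φ)
      (fun j => AddMonoidAlgebra.single 0 (MvPolynomial.X j)))
    ((AddMonoidAlgebra.of _ _).comp (AddMonoidHom.inr Λ (Fin m → ℤ)).toMultiplicative)
    (fun _ _ => Commute.all _ _)

lemma torusMap_single_monomial (l : Fin m → ℤ) (k : Fin m →₀ ℕ) (c : S) :
    torusMap m Φ (AddMonoidAlgebra.single l (MvPolynomial.monomial k c)) =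
      laurentIncl R P Λ m (Φ c) *
        AddMonoidAlgebra.single (0, l) (MvPolynomial.monomial k 1) := by
  rw [torusMap, AddMonoidAlgebra.coe_liftNCAlgHom, AddMonoidAlgebra.liftNC_single]
  have h1 : (MvPolynomial.aevalTower ((laurentIncl R P Λ m).comp Φ)
      (fun j => AddMonoidAlgebra.single (0 : Λ × (Fin m → ℤ)) (MvPolynomial.X j)))
      (MvPolynomial.monomial k c) = laurentIncl R P Λ m (Φ c) *
        AddMonoidAlgebra.single 0 (MvPolynomial.monomial k 1) := by
    rw [MvPolynomial.monomial_eq, map_mul, MvPolynomial.aevalTower_C, AlgHom.comp_apply,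
      MvPolynomial.monomial_eq, MvPolynomial.C_1, one_mul]
    congr 1
    rw [Finsupp.prod, Finsupp.prod, map_prod]
    simp only [map_pow, MvPolynomial.aevalTower_X, AddMonoidAlgebra.single_pow,
      AddMonoidAlgebra.prod_single, smul_zero, Finset.sum_const_zero]
  have h2 : ((AddMonoidAlgebra.of (MvPolynomial (Fin m) P) (Λ × (Fin m → ℤ))).comp
      (AddMonoidHom.inr Λ (Fin m → ℤ)).toMultiplicative) (Multiplicative.ofAdd l) =
      AddMonoidAlgebra.single (0, l) 1 := rfl
  erw [h1, h2]
  rw [mul_assoc, AddMonoidAlgebra.single_mul_single, zero_add, mul_one]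

lemma coeff_torusMap (f : TorusRing m S) (v : Λ) (l : Fin m → ℤ) (k : Fin m →₀ ℕ) :
    ((torusMap m Φ f).coeff (v, l)).coeff k = (Φ ((f.coeff l).coeff k)).coeff v := by
  classical
  induction f using AddMonoidAlgebra.induction_linear with
  | zero => simp
  | add f g hf hg => simp [hf, hg]
  | single l' p =>
    induction p using MvPolynomial.induction_on' with
    | add p q hp hq => simp only [AddMonoidAlgebra.single_add, map_add,
        AddMonoidAlgebra.coeff_add, Finsupp.add_apply, MvPolynomial.coeff_add, hp, hq]
    | monomial k' c =>
      rw [torusMap_single_monomial]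
      have hR : Φ (((AddMonoidAlgebra.single l' (MvPolynomial.monomial k' c)).coeff l).coeff k) =
          if l' = l ∧ k' = k then Φ c else 0 := by
        rw [AddMonoidAlgebra.coeff_single, Finsupp.single_apply]
        by_cases h1 : l' = l
        · by_cases h2 : k' = k
          · simp [h1, h2]
          · simp [h1, h2, MvPolynomial.coeff_monomial]
        · simp [h1]
      rw [hR]
      generalize Φ c = g
      induction g using AddMonoidAlgebra.induction_linear with
      | zero => simp
      | add g g' hg hg' =>
        simp only [map_add, add_mul, AddMonoidAlgebra.coeff_add, Finsupp.add_apply,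
          MvPolynomial.coeff_add, hg, hg']
        split_ifs <;> simp
      | single v' p =>
        rw [laurentIncl_single, AddMonoidAlgebra.single_mul_single,
          MvPolynomial.C_mul_monomial, mul_one, AddMonoidAlgebra.coeff_single,
          Finsupp.single_apply]
        by_cases h1 : l' = l
        · by_cases h2 : k' = k
          · by_cases h3 : v' = v
            · simp [h1, h2, h3]
            · simp [h1, h2, h3]
          · by_cases h3 : v' = v
            · simp [h1, h2, h3, MvPolynomial.coeff_monomial]
            · simp [h1, h2, h3]
        · simp [h1]

lemma torusMap_injective (hΦ : Function.Injective Φ) : Function.Injective (torusMap m Φ) := by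
  rw [injective_iff_map_eq_zero]
  intro f hf
  ext l k
  refine hΦ ?_
  rw [AddMonoidAlgebra.coeff_zero, Finsupp.coe_zero, Pi.zero_apply, MvPolynomial.coeff_zero,
    map_zero]
  ext v
  rw [← coeff_torusMap, hf]
  simp

/-- If the image of `S → P[Λ]` is cut out by divisibility of coefficients, then so is the image of
the extended map. -/
lemma exists_torusMap_eq_iff (wt : Λ → P)
    (hΦ : ∀ g, (∃ f, Φ f = g) ↔ ∀ v, wt v ∣ g.coeff v)
    (g : AddMonoidAlgebra (MvPolynomial (Fin m) P) (Λ × (Fin m → ℤ))) :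
    (∃ f, torusMap m Φ f = g) ↔ ∀ v l, MvPolynomial.C (wt v) ∣ g.coeff (v, l) := by
  classical
  constructor
  · rintro ⟨f, rfl⟩ v l
    rw [MvPolynomial.C_dvd_iff_dvd_coeff]
    intro k
    rw [coeff_torusMap]
    exact (hΦ _).mp ⟨_, rfl⟩ v
  · intro hg
    change g ∈ LinearMap.range (torusMap m Φ).toLinearMap
    refine AddMonoidAlgebra.mem_submodule_of_single _ g ?_
    rintro ⟨v, l⟩
    have h := (MvPolynomial.C_dvd_iff_dvd_coeff _ _).mp (hg v l)
    rw [MvPolynomial.as_sum (g.coeff (v, l))]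
    have hsum : AddMonoidAlgebra.single (v, l) (∑ k ∈ (g.coeff (v, l)).support,
        MvPolynomial.monomial k ((g.coeff (v, l)).coeff k)) =
        ∑ k ∈ (g.coeff (v, l)).support, AddMonoidAlgebra.single (v, l)
          (MvPolynomial.monomial k ((g.coeff (v, l)).coeff k)) :=
      map_sum (AddMonoidAlgebra.singleAddHom (v, l)) _ _
    rw [hsum]
    refine Submodule.sum_mem _ fun k _ => ?_
    obtain ⟨c, hc⟩ := (hΦ (AddMonoidAlgebra.single v ((g.coeff (v, l)).coeff k))).mpr fun v' => by
      rw [AddMonoidAlgebra.coeff_single, Finsupp.single_apply]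
      split_ifs with hv
      · exact hv ▸ h k
      · exact dvd_zero _
    refine ⟨AddMonoidAlgebra.single l (MvPolynomial.monomial k c), ?_⟩
    rw [AlgHom.toLinearMap_apply, torusMap_single_monomial, hc, laurentIncl_single,
      AddMonoidAlgebra.single_mul_single, MvPolynomial.C_mul_monomial, mul_one, Prod.mk_add_mk,
      add_zero, zero_add]

end TorusEmbedding

/-! ### Linear forms in the coordinates of an adapted basis -/

lemma sum_single_sub_smul {ι : Type} [Fintype ι] [DecidableEq ι] {M : Type*} [AddCommGroup M]
    (u : ι → M) {κ : Type} [Fintype κ] (i : ι) (t : κ → ι) (N : ℤ) (k : κ → ℤ) :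
    ∑ x, (N • (Pi.single i 1 : ι → ℤ) - ∑ j, k j • (Pi.single (t j) 1 : ι → ℤ)) x • u x =
      N • u i - ∑ j, k j • u (t j) := by
  simp only [Pi.sub_apply, Pi.smul_apply, Finset.sum_apply, sub_smul, Finset.sum_sub_distrib,
    Finset.sum_smul, smul_assoc]
  rw [Finset.sum_comm]
  simp [Pi.single_apply, ite_smul]

lemma sum_extend_smul {n : ℕ} {F : Finset (Fin n)} (l : F → ℤ) {M : Type*} [AddCommGroup M]
    (u : Fin n → M) :
    ∑ i, (if h : i ∈ F then l ⟨i, h⟩ else 0) • u i = ∑ i : F, l i • u i := by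
  rw [← Finset.sum_subset (Finset.subset_univ F) (fun i _ hi => by simp [hi]),
    ← Finset.sum_coe_sort F]
  exact Finset.sum_congr rfl fun i _ => by simp

/-- Linear relations between the `a_i` hold for any family satisfying the relations in `𝔱^k`. -/
lemma smul_eq_sum_smul_of_lieKernel {ι : Type} [Fintype ι] [DecidableEq ι] {d : ℕ}
    (a : Matrix ι (Fin d) ℤ) {M : Type*} [AddCommGroup M] (u : ι → M)
    (hu : ∀ l ∈ lieKernel a, ∑ i, l i • u i = 0) {κ : Type} [Fintype κ] (i : ι) (t : κ → ι)
    (N : ℤ) (k : κ → ℤ) (h : N • a i = ∑ j, k j • a (t j)) :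
    N • u i = ∑ j, k j • u (t j) := by
  have h0 := hu (N • (Pi.single i 1 : ι → ℤ) - ∑ j, k j • (Pi.single (t j) 1 : ι → ℤ)) ?_
  · rw [sum_single_sub_smul] at h0
    exact sub_eq_zero.mp h0
  · change _ ᵥ* a = 0
    ext x
    have h1 := congrFun (sum_single_sub_smul (fun i => (a i : Fin d → ℤ)) i t N k) x
    rw [h, sub_self] at h1
    rw [← h1]
    simp [vecMul, dotProduct, Finset.sum_apply]

namespace AdaptedBasis

variable {n d : ℕ} {a : Matrix (Fin n) (Fin d) ℤ} {F : Finset (Fin n)} (A : AdaptedBasis a F)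
variable (R : Type u) [CommRing R]

/-- The coefficient of `a_{τ j}` in the expansion of `a_i` over a ring in which `det mat` is
invertible. -/
def rcoef (i : Fin n) (j : Fin A.r ⊕ Fin A.m) : R :=
  Ring.inverse ((A.mat.det : ℤ) : R) * (A.coef i j : R)

/-- The linear form `a_i`, for `i ∈ F`, in the coordinates `a_{τ j}`, `j ≤ r`. -/
def locForm (i : Fin n) : MvPolynomial (Fin A.r) R :=
  ∑ j, A.rcoef R i (Sum.inl j) • MvPolynomial.X j

/-- The linear form `a_i` in the coordinates `a_{τ j}`. -/
def form (i : Fin n) : MvPolynomial (Fin A.m) (MvPolynomial (Fin A.r) R) :=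
  MvPolynomial.C (A.locForm R i) + ∑ j, A.rcoef R i (Sum.inr j) • MvPolynomial.X j

lemma form_eq_sum (i : Fin n) : A.form R i = ∑ j, A.rcoef R i j •
    (Sum.elim (fun j => MvPolynomial.C (MvPolynomial.X j)) MvPolynomial.X j :
      MvPolynomial (Fin A.m) (MvPolynomial (Fin A.r) R)) := by
  rw [Fintype.sum_sum_type, form, locForm, map_sum]
  congr 1
  refine Finset.sum_congr rfl fun j _ => ?_
  exact map_smul (IsScalarTower.toAlgHom R (MvPolynomial (Fin A.r) R)
    (MvPolynomial (Fin A.m) (MvPolynomial (Fin A.r) R))) _ _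

/-- The reduction modulo the first `r` coordinates, that is, the restriction to `H_F`. -/
def restrict : MvPolynomial (Fin A.m) (MvPolynomial (Fin A.r) R) →+* MvPolynomial (Fin A.m) R :=
  MvPolynomial.map MvPolynomial.constantCoeff

lemma restrict_form (i : Fin n) :
    A.restrict R (A.form R i) = ∑ j, A.rcoef R i (Sum.inr j) • MvPolynomial.X j := by
  have h0 : MvPolynomial.constantCoeff (A.locForm R i) = 0 := by
    simp [locForm, MvPolynomial.constantCoeff_smul]
  rw [form, map_add, restrict, MvPolynomial.map_C, h0, map_zero, zero_add, map_sum]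
  refine Finset.sum_congr rfl fun j _ => ?_
  rw [Algebra.smul_def, map_mul, MvPolynomial.map_X, Algebra.smul_def]
  congr 1
  rw [IsScalarTower.algebraMap_apply R (MvPolynomial (Fin A.r) R), MvPolynomial.algebraMap_eq,
    MvPolynomial.algebraMap_eq, MvPolynomial.algebraMap_eq, MvPolynomial.map_C,
    MvPolynomial.constantCoeff_C]

variable (hR : ∀ t : Fin d → Fin n, (a.submatrix t id).det ≠ 0 →
  IsUnit (((a.submatrix t id).det : ℤ) : R))

include hR in
lemma isUnit_det_cast (t : Fin A.r ⊕ Fin A.m → Fin n) (ht : (a.submatrix t A.e).det ≠ 0) :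
    IsUnit (((a.submatrix t A.e).det : ℤ) : R) := by
  have h : (a.submatrix t A.e).det = (a.submatrix (t ∘ A.e.symm) id).det := by
    rw [← det_submatrix_equiv_self A.e (a.submatrix (t ∘ A.e.symm) id), submatrix_submatrix]
    congr 2
    ext j
    simp
  rw [h] at ht ⊢
  exact hR _ ht

include hR in
lemma isUnit_det : IsUnit ((A.mat.det : ℤ) : R) := A.isUnit_det_cast R hR A.τ A.det_ne

include hR in
/-- By Cramer's rule, the coefficient is a quotient of two maximal minors. -/
lemma isUnit_rcoef (i : Fin n) (j : Fin A.r ⊕ Fin A.m) (h : A.coef i j ≠ 0) :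
    IsUnit (A.rcoef R i j) := by
  refine IsUnit.mul ?_ ?_
  · exact (A.isUnit_det R hR).ringInverse
  · rw [coef_eq_det] at h ⊢
    exact A.isUnit_det_cast R hR _ h

include hR in
lemma rcoef_eq_zero_or_isUnit (i : Fin n) (j : Fin A.r ⊕ Fin A.m) :
    A.rcoef R i j = 0 ∨ IsUnit (A.rcoef R i j) := by
  by_cases h : A.coef i j = 0
  · left; rw [rcoef, h, Int.cast_zero, mul_zero]
  · exact Or.inr (A.isUnit_rcoef R hR i j h)

include hR in
lemma rcoef_τ (k j : Fin A.r ⊕ Fin A.m) : A.rcoef R (A.τ k) j = if k = j then 1 else 0 := by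
  rw [rcoef, coef_τ]
  split_ifs
  · exact Ring.inverse_mul_cancel _ (A.isUnit_det R hR)
  · simp

lemma rcoef_inr_of_mem (i : Fin n) (hi : i ∈ F) (j : Fin A.m) : A.rcoef R i (Sum.inr j) = 0 := by
  rw [rcoef, A.coef_inr_eq_zero_of_mem i hi, Int.cast_zero, mul_zero]

lemma form_of_mem (i : Fin n) (hi : i ∈ F) : A.form R i = MvPolynomial.C (A.locForm R i) := by
  simp [form, A.rcoef_inr_of_mem R i hi]

lemma restrict_form_of_mem (i : Fin n) (hi : i ∈ F) : A.restrict R (A.form R i) = 0 := by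
  simp [restrict_form, A.rcoef_inr_of_mem R i hi]

include hR in
lemma form_τ (k : Fin A.r ⊕ Fin A.m) : A.form R (A.τ k) =
    Sum.elim (fun j => MvPolynomial.C (MvPolynomial.X j)) MvPolynomial.X k := by
  rw [form_eq_sum]
  simp [A.rcoef_τ R hR]

include hR in
lemma locForm_τ (k : Fin A.r) : A.locForm R (A.τ (Sum.inl k)) = MvPolynomial.X k := by
  simp [locForm, A.rcoef_τ R hR]

include hR in
lemma form_mem_nonZeroDivisors (i : Fin n) (hi : a i ≠ 0) :
    A.form R i ∈ nonZeroDivisors (MvPolynomial (Fin A.m) (MvPolynomial (Fin A.r) R)) := by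
  let E := (MvPolynomial.renameEquiv R (Equiv.sumComm (Fin A.r) (Fin A.m))).trans
    (MvPolynomial.sumAlgEquiv R (Fin A.m) (Fin A.r))
  have h1 : A.form R i = E (∑ j, A.rcoef R i j • MvPolynomial.X j) := by
    rw [form_eq_sum, map_sum]
    refine Finset.sum_congr rfl fun j _ => ?_
    rw [map_smul]
    congr 1
    rcases j with j | j <;> simp [E]
  obtain ⟨j, hj⟩ := A.exists_coef_ne_zero i hi
  have h2 := MvPolynomial.sum_smul_X_mem_nonZeroDivisors (A.rcoef R i)
    (A.rcoef_eq_zero_or_isUnit R hR i) ⟨j, A.isUnit_rcoef R hR i j hj⟩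
  refine mem_nonZeroDivisors_of_injective (f := E.symm) E.symm.injective ?_
  rwa [h1, AlgEquiv.symm_apply_apply]

include hR in
lemma locForm_mem_nonZeroDivisors (i : Fin n) (hi : a i ≠ 0) (hiF : i ∈ F) :
    A.locForm R i ∈ nonZeroDivisors (MvPolynomial (Fin A.r) R) := by
  obtain ⟨j, hj⟩ := A.exists_coef_ne_zero i hi
  rcases j with j | j
  · exact MvPolynomial.sum_smul_X_mem_nonZeroDivisors (fun j => A.rcoef R i (Sum.inl j))
      (fun j => A.rcoef_eq_zero_or_isUnit R hR i _) ⟨j, A.isUnit_rcoef R hR i _ hj⟩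
  · exact absurd (A.coef_inr_eq_zero_of_mem i hiF j) hj

include hR in
/-- For `i` outside the flat `F`, the hyperplane `H_i` does not contain `H_F`. -/
lemma restrict_form_mem_nonZeroDivisors (hF : IsFlat a F) (i : Fin n) (hiF : i ∉ F) :
    A.restrict R (A.form R i) ∈ nonZeroDivisors (MvPolynomial (Fin A.m) R) := by
  obtain ⟨j, hj⟩ := A.exists_coef_inr_ne_zero hF i hiF
  rw [restrict_form]
  exact MvPolynomial.sum_smul_X_mem_nonZeroDivisors (fun j => A.rcoef R i (Sum.inr j))
    (fun j => A.rcoef_eq_zero_or_isUnit R hR i _) ⟨j, A.isUnit_rcoef R hR i _ hj⟩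

lemma sum_smul_rcoef (l : Fin n → ℤ) (hl : l ∈ lieKernel a) (j : Fin A.r ⊕ Fin A.m) :
    ∑ i, l i • A.rcoef R i j = 0 := by
  have h : ∑ i, l i * A.coef i j = 0 := by
    have h1 : l ᵥ* a = 0 := hl
    have h2 : (l ᵥ* a) ⬝ᵥ A.dualVec j = 0 := by rw [h1, zero_dotProduct]
    rwa [← dotProduct_mulVec] at h2
  have h3 : ∑ i, l i • A.rcoef R i j =
      Ring.inverse ((A.mat.det : ℤ) : R) * ((∑ i, l i * A.coef i j : ℤ) : R) := by
    rw [Int.cast_sum, Finset.mul_sum]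
    refine Finset.sum_congr rfl fun i _ => ?_
    rw [rcoef, zsmul_eq_mul, Int.cast_mul]
    ring
  rw [h3, h, Int.cast_zero, mul_zero]

lemma sum_smul_form (l : Fin n → ℤ) (hl : l ∈ lieKernel a) : ∑ i, l i • A.form R i = 0 := by
  simp only [form_eq_sum, Finset.smul_sum]
  rw [Finset.sum_comm]
  refine Finset.sum_eq_zero fun j _ => ?_
  simp only [← smul_assoc]
  rw [← Finset.sum_smul, A.sum_smul_rcoef R l hl, zero_smul]

lemma sum_smul_locForm (l : F → ℤ) (hl : l ∈ lieKernel (localization a F)) :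
    ∑ i, l i • A.locForm R i = 0 := by
  let l' : Fin n → ℤ := fun i => if h : i ∈ F then l ⟨i, h⟩ else 0
  have hl' : l' ∈ lieKernel a := by
    change l' ᵥ* a = 0
    have h1 : l ᵥ* localization a F = 0 := hl
    ext x
    rw [← h1]
    exact sum_extend_smul l (fun i => a i x)
  rw [← sum_extend_smul l (A.locForm R)]
  change ∑ i, l' i • _ = _
  simp only [locForm, Finset.smul_sum]
  rw [Finset.sum_comm]
  refine Finset.sum_eq_zero fun j _ => ?_
  simp only [← smul_assoc]
  rw [← Finset.sum_smul, A.sum_smul_rcoef R l' hl', zero_smul]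

include hR in
lemma eq_sum_rcoef_smul {M : Type*} [AddCommGroup M] [Module R M] (u : Fin n → M)
    (hu : ∀ l ∈ lieKernel a, ∑ i, l i • u i = 0) (i : Fin n) :
    u i = ∑ j, A.rcoef R i j • u (A.τ j) := by
  have h := smul_eq_sum_smul_of_lieKernel a u hu i A.τ _ _ (A.det_smul_eq i)
  simp only [rcoef, mul_smul, ← Finset.smul_sum, Int.cast_smul_eq_zsmul]
  rw [← h, ← Int.cast_smul_eq_zsmul R, smul_smul,
    Ring.inverse_mul_cancel _ (A.isUnit_det R hR), one_smul]

include hR in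
lemma eq_sum_rcoef_smul_of_mem {M : Type*} [AddCommGroup M] [Module R M] (u : F → M)
    (hu : ∀ l ∈ lieKernel (localization a F), ∑ i, l i • u i = 0) (i : F) :
    u i = ∑ j, A.rcoef R i (Sum.inl j) • u ⟨A.τ (Sum.inl j), A.τ_mem j⟩ := by
  have h := smul_eq_sum_smul_of_lieKernel (localization a F) u hu i
    (fun j => ⟨A.τ (Sum.inl j), A.τ_mem j⟩) A.mat.det (fun j => A.coef i (Sum.inl j)) (by
      have := A.det_smul_eq i
      rw [Fintype.sum_sum_type] at this
      simp only [A.coef_inr_eq_zero_of_mem i i.2, zero_smul, Finset.sum_const_zero,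
        add_zero] at this
      exact this)
  simp only [rcoef, mul_smul, ← Finset.smul_sum, Int.cast_smul_eq_zsmul]
  rw [← h, ← Int.cast_smul_eq_zsmul R, smul_smul,
    Ring.inverse_mul_cancel _ (A.isUnit_det R hR), one_smul]

include hR in
/-- The linear forms `a_i` satisfy no polynomial relations other than those that follow from the
relations in `𝔱^k`: the `a_{τ j}` are independent, and the other `a_i` are combinations of them. -/
lemma aeval_eq_zero_of_form {M : Type*} [CommRing M] [Algebra R M] (u : Fin n → M)
    (hu : ∀ l ∈ lieKernel a, ∑ i, l i • u i = 0) (q : MvPolynomial (Fin n) R)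
    (hq : MvPolynomial.aeval (A.form R) q = 0) : MvPolynomial.aeval u q = 0 := by
  let s : MvPolynomial (Fin A.m) (MvPolynomial (Fin A.r) R) →ₐ[R] M :=
    MvPolynomial.aevalTower (MvPolynomial.aeval fun j => u (A.τ (Sum.inl j)))
      fun j => u (A.τ (Sum.inr j))
  have hs : ∀ i, s (A.form R i) = u i := by
    intro i
    rw [A.eq_sum_rcoef_smul R hR u hu i, form_eq_sum, map_sum]
    refine Finset.sum_congr rfl fun j _ => ?_
    rw [map_smul]
    rcases j with j | j <;> simp [s]
  have h := MvPolynomial.comp_aeval_apply (A.form R) s q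
  rw [hq, map_zero] at h
  simp only [hs] at h
  exact h.symm

include hR in
lemma aeval_eq_zero_of_locForm {M : Type*} [CommRing M] [Algebra R M] (u : F → M)
    (hu : ∀ l ∈ lieKernel (localization a F), ∑ i, l i • u i = 0) (q : MvPolynomial F R)
    (hq : MvPolynomial.aeval (fun i : F => A.locForm R i) q = 0) : MvPolynomial.aeval u q = 0 := by
  let s : MvPolynomial (Fin A.r) R →ₐ[R] M :=
    MvPolynomial.aeval fun j => u ⟨A.τ (Sum.inl j), A.τ_mem j⟩
  have hs : ∀ i : F, s (A.locForm R i) = u i := by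
    intro i
    rw [A.eq_sum_rcoef_smul_of_mem R hR u hu i, locForm, map_sum]
    refine Finset.sum_congr rfl fun j _ => ?_
    rw [map_smul]
    simp [s]
  have h := MvPolynomial.comp_aeval_apply (fun i : F => A.locForm R i) s q
  rw [hq, map_zero] at h
  simp only [hs] at h
  exact h.symm

include hR in
lemma aeval_form_surjective : Function.Surjective
    (MvPolynomial.aeval (A.form R) : MvPolynomial (Fin n) R →ₐ[R] _) := by
  let s : MvPolynomial (Fin A.m) (MvPolynomial (Fin A.r) R) →ₐ[R] MvPolynomial (Fin n) R :=
    MvPolynomial.aevalTower (MvPolynomial.aeval fun j => MvPolynomial.X (A.τ (Sum.inl j)))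
      fun j => MvPolynomial.X (A.τ (Sum.inr j))
  have hs : ((MvPolynomial.aeval (A.form R)).comp s : _ →ₐ[R] _).toRingHom = RingHom.id _ := by
    refine MvPolynomial.ringHom_ext' (MvPolynomial.ringHom_ext (fun r => ?_) fun j => ?_)
      fun j => ?_
    · simp [s]
    · simp [s, A.form_τ R hR]
    · simp [s, A.form_τ R hR]
  exact fun p => ⟨s p, RingHom.congr_fun hs p⟩

include hR in
lemma aeval_locForm_surjective : Function.Surjective
    (MvPolynomial.aeval (fun i : F => A.locForm R i) : MvPolynomial F R →ₐ[R] _) := by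
  let s : MvPolynomial (Fin A.r) R →ₐ[R] MvPolynomial F R :=
    MvPolynomial.aeval fun j => MvPolynomial.X ⟨A.τ (Sum.inl j), A.τ_mem j⟩
  have hs : (MvPolynomial.aeval (fun i : F => A.locForm R i)).comp s = AlgHom.id R _ := by
    refine MvPolynomial.algHom_ext fun j => ?_
    simp [s, A.locForm_τ R hR]
  exact fun p => ⟨s p, AlgHom.congr_fun hs p⟩

include hR in
/-- The polynomials vanishing on `H_F` form the ideal generated by the `a_i` with `i ∈ F`. -/
lemma mem_span_form_of_restrict_eq_zero
    (p : MvPolynomial (Fin A.m) (MvPolynomial (Fin A.r) R)) (hp : A.restrict R p = 0) :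
    p ∈ Ideal.span (A.form R '' F) := by
  have h1 : p ∈ RingHom.ker (MvPolynomial.map (σ := Fin A.m)
    (MvPolynomial.constantCoeff (R := R) (σ := Fin A.r))) := hp
  rw [MvPolynomial.ker_map] at h1
  have h2 : ∀ f : MvPolynomial (Fin A.r) R, f - MvPolynomial.C (MvPolynomial.constantCoeff f) ∈
      Ideal.span (Set.range MvPolynomial.X) := by
    intro f
    induction f using MvPolynomial.induction_on with
    | C c => simp
    | add f g hf hg =>
      convert! Ideal.add_mem _ hf hg using 1
      simp only [map_add]
      ring
    | mul_X f j _ =>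
      simpa using Ideal.mul_mem_left (Ideal.span (Set.range MvPolynomial.X)) f
        (Ideal.subset_span ⟨j, rfl⟩)
  refine (Ideal.map_le_iff_le_comap.mpr fun f hf => ?_ :
    Ideal.map MvPolynomial.C (RingHom.ker MvPolynomial.constantCoeff) ≤ _) h1
  have h3 := h2 f
  rw [RingHom.mem_ker.mp hf, map_zero, sub_zero] at h3
  refine (Ideal.span_le.mpr ?_ : Ideal.span (Set.range MvPolynomial.X) ≤ _) h3
  rintro _ ⟨j, rfl⟩
  exact Ideal.subset_span ⟨A.τ (Sum.inl j), A.τ_mem j, A.form_τ R hR (Sum.inl j)⟩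

end AdaptedBasis

/-! ### The chart of the hypertoric variety around a stratum, on functions -/

/-- The restriction of functions from `X × 𝔸^m × 𝔾_m^m` to `{x} × 𝔸^m × 𝔾_m^m`, for an affine scheme
`X = Spec S` with an `R`-valued point `x`. -/
def torusEval (m : ℕ) {S R : Type u} [CommRing S] [CommRing R] (x : S →+* R) :
    TorusRing m S →+* TorusRing m R :=
  AddMonoidAlgebra.mapRingHom _ (MvPolynomial.map x)

lemma coeff_torusEval (m : ℕ) {S R : Type u} [CommRing S] [CommRing R] (x : S →+* R)
    (f : TorusRing m S) (l : Fin m → ℤ) (k : Fin m →₀ ℕ) :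
    ((torusEval m x f).coeff l).coeff k = x ((f.coeff l).coeff k) := by
  rw [torusEval, AddMonoidAlgebra.coeff_mapRingHom, MvPolynomial.coeff_map]

/-- Under the embedding into Laurent polynomials, evaluation at the origin is the constant term: the
monomials of nonzero weight and the `z_i w_i` vanish there. -/
lemma evalOrigin_eq_constantCoeff {ι : Type} [Fintype ι] [DecidableEq ι] {d : ℕ}
    (a : Matrix ι (Fin d) ℤ) (R : Type u) [CommRing R] {κ Λ : Type} [AddCommGroup Λ]
    (b : ι → MvPolynomial κ R) (hb : ∀ i, MvPolynomial.constantCoeff (b i) = 0)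
    (χ : Λ →+ (ι → ℤ)) (hχ : Function.Injective χ) (hχ1 : ∀ w, ∃ v, χ v = a *ᵥ w) (σ : ι → ℤ)
    (Φ : invariants a R →ₐ[R] AddMonoidAlgebra (MvPolynomial κ R) Λ)
    (hq : ∀ q : MvPolynomial ι R, Φ (MvPolynomial.aeval (invU a R) q) =
      AddMonoidAlgebra.single 0 (MvPolynomial.aeval b q))
    (hm : ∀ w v, χ v = a *ᵥ w → Φ (invMono a R w) =
      AddMonoidAlgebra.single v (negWeight b (σ * χ v)))
    (f : invariants a R) :
    evalOrigin a R f = MvPolynomial.constantCoeff ((Φ f).coeff 0) := by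
  classical
  have h := mem_span_invariants a R f
  induction h using Submodule.span_induction with
  | mem x hx =>
    obtain ⟨⟨κ', w⟩, rfl⟩ := hx
    obtain ⟨v, hv⟩ := hχ1 w
    have h1 : (∏ i, invU a R i ^ κ' i) =
        MvPolynomial.aeval (invU a R) (∏ i, MvPolynomial.X i ^ κ' i : MvPolynomial ι R) := by
      simp
    have h2 : Φ ((∏ i, invU a R i ^ κ' i) * invMono a R w) =
        AddMonoidAlgebra.single v ((∏ i, b i ^ κ' i) * negWeight b (σ * χ v)) := by
      rw [map_mul, h1, hq, hm w v hv, AddMonoidAlgebra.single_mul_single, zero_add]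
      simp
    dsimp only
    rw [h2, map_mul, map_prod, AddMonoidAlgebra.coeff_single, Finsupp.single_apply,
      evalOrigin_invMono]
    have h3 : v = 0 ↔ a *ᵥ w = 0 := by rw [← hv, map_eq_zero_iff χ hχ]
    by_cases hw : a *ᵥ w = 0
    · have hv0 := h3.mpr hw
      subst hv0
      rw [if_pos hw, if_pos rfl, map_mul, map_prod]
      simp [evalOrigin_invU, hb, negWeight]
    · rw [if_neg hw, if_neg (fun h => hw (h3.mp h)), mul_zero, map_zero]
  | zero => simp
  | add x y _ _ hx hy => simp [hx, hy]
  | smul r x _ hx => simp [hx, MvPolynomial.constantCoeff_smul]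

/-- The invariant function whose non-vanishing defines the chart of `𝔐(𝒜)` around the stratum of `F`
attached to `w`, a vector orthogonal to the `a_i` with `i ∈ F`. -/
def chartFn {n d : ℕ} (a : Matrix (Fin n) (Fin d) ℤ) (R : Type u) [CommRing R]
    (F : Finset (Fin n)) (w : Fin d → ℤ) : invariants a R :=
  invMono a R w * ∏ i with i ∉ F ∧ (a *ᵥ w) i = 0, invU a R i

namespace AdaptedBasis

variable {n d : ℕ} {a : Matrix (Fin n) (Fin d) ℤ} {F : Finset (Fin n)} (A : AdaptedBasis a F)
variable (R : Type u) [CommRing R]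

lemma constantCoeff_locForm (i : Fin n) :
    MvPolynomial.constantCoeff (A.locForm R i) = 0 := by
  simp [locForm, MvPolynomial.constantCoeff_smul]

lemma negWeight_form (σ γ : Fin n → ℤ) (hσ : ∀ i ∈ F, σ i = 1) (v : F → ℤ)
    (hv : ∀ i : F, γ i = v i) :
    negWeight (A.form R) (σ * γ) =
      MvPolynomial.C (negWeight (fun i : F => A.locForm R i) v) *
        ∏ i ∈ Fᶜ, A.form R i ^ (-(σ i * γ i)).toNat := by
  rw [negWeight, ← Finset.prod_mul_prod_compl F, negWeight, map_prod, ← Finset.prod_coe_sort F]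
  congr 1
  refine Finset.prod_congr rfl fun i _ => ?_
  rw [Pi.mul_apply, hσ i i.2, one_mul, hv, map_pow, A.form_of_mem R i i.2]

variable (hR : ∀ t : Fin d → Fin n, (a.submatrix t id).det ≠ 0 →
  IsUnit (((a.submatrix t id).det : ℤ) : R))

include hR in
/-- The chart attached to `w`. The functions on `𝔐(𝒜)` are embedded into those on
`𝔐(𝒜_F) × 𝔸^m × 𝔾_m^m`, and both rings agree after inverting `chartFn`. The stratum of `F`
corresponds to `{0} × 𝔸^m × 𝔾_m^m`. -/
theorem exists_chart (ha : ∀ i, a i ≠ 0) (hF : IsFlat a F) (w : Fin d → ℤ)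
    (hw : ∀ i ∈ F, (a *ᵥ w) i = 0) :
    ∃ φ : invariants a R →ₐ[R] TorusRing A.m (invariants (localization a F) R),
      Function.Injective φ ∧
      (∀ b, ∃ (N : ℕ) (f : invariants a R), φ f = φ (chartFn a R F w) ^ N * b) ∧
      (∀ f, torusEval A.m (evalOrigin (localization a F) R).toRingHom (φ f) = 0 ↔
        f ∈ vanishingIdeal a R F) ∧
      φ (chartFn a R F w) ∈ nonZeroDivisors _ ∧
      torusEval A.m (evalOrigin (localization a F) R).toRingHom (φ (chartFn a R F w)) ∈
        nonZeroDivisors _ := by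
  classical
  -- Signs are chosen so that the monomial of `w` becomes a product of coordinates on the torus.
  let σ : Fin n → ℤ := fun i => if 0 ≤ (a *ᵥ w) i then 1 else -1
  have hσ : ∀ i, σ i = 1 ∨ σ i = -1 := fun i => by simp only [σ]; split_ifs <;> simp
  have hσF : ∀ i ∈ F, σ i = 1 := fun i hi => by simp [σ, hw i hi]
  have hσw : ∀ i, σ i * (a *ᵥ w) i = |(a *ᵥ w) i| := fun i => by
    simp only [σ]
    split_ifs with h
    · rw [one_mul, abs_of_nonneg h]
    · rw [neg_one_mul, abs_of_neg (not_le.mp h)]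
  obtain ⟨χ, hχ, hχ1, hχ2, hχF⟩ := A.exists_splitting
  obtain ⟨Φ, hΦinj, hΦq, hΦm, hΦr⟩ := exists_invariants_embedding a R (A.form R) σ hσ
    (A.sum_smul_form R) χ (fun i => A.form_mem_nonZeroDivisors R hR i (ha i))
    (A.aeval_eq_zero_of_form R hR _ (sum_smul_momentCoord a R)) (A.aeval_form_surjective R hR)
    hχ hχ1 hχ2
  let χ₁ := (Submodule.subtype (LinearMap.range (localization a F).mulVecLin)).toAddMonoidHom
  have hχ₁ : Function.Injective χ₁ := Subtype.val_injective
  have hχ₁1 : ∀ w, ∃ v, χ₁ v = localization a F *ᵥ w := fun w => ⟨⟨_, w, rfl⟩, rfl⟩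
  obtain ⟨Φ₁, hΦ₁inj, hΦ₁q, hΦ₁m, hΦ₁r⟩ := exists_invariants_embedding (localization a F) R
    (fun i : F => A.locForm R i) (fun _ => 1) (fun _ => Or.inl rfl)
    (A.sum_smul_locForm R) χ₁ (fun i => A.locForm_mem_nonZeroDivisors R hR i (ha i) i.2)
    (A.aeval_eq_zero_of_locForm R hR _ (sum_smul_momentCoord _ R))
    (A.aeval_locForm_surjective R hR) hχ₁ hχ₁1 (by rintro ⟨_, w, rfl⟩; exact ⟨w, rfl⟩)
  let Ω := torusMap A.m Φ₁
  have hΩ : Function.Injective Ω := torusMap_injective A.m Φ₁ hΦ₁inj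
  have hΩr := exists_torusMap_eq_iff A.m Φ₁ _ hΦ₁r
  have hwt : ∀ v, negWeight (A.form R) (σ * χ v) =
      MvPolynomial.C (negWeight (fun i : F => A.locForm R i) ((fun _ => 1) * χ₁ v.1)) *
        ∏ i ∈ Fᶜ, A.form R i ^ (-(σ i * χ v i)).toNat := fun v =>
    A.negWeight_form R σ _ hσF _ fun i => by
      rw [hχF, Pi.mul_apply, one_mul]
      rfl
  obtain ⟨φ, hφ⟩ := AlgHom.exists_comp_eq_of_range_le Φ Ω hΩ fun x => by
    refine (hΩr _).mpr fun v l => ?_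
    exact (Dvd.intro _ (hwt (v, l)).symm).trans ((hΦr _).mp ⟨x, rfl⟩ (v, l))
  have hφinj : Function.Injective φ := fun x y h => hΦinj (by rw [← hφ, ← hφ, h])
  -- Restriction to the stratum in terms of coefficients.
  have hcoeff : ∀ b l, (torusEval A.m (evalOrigin (localization a F) R).toRingHom b).coeff l =
      A.restrict R ((Ω b).coeff (0, l)) := by
    intro b l
    ext k
    rw [coeff_torusEval, restrict, MvPolynomial.coeff_map, coeff_torusMap]
    exact evalOrigin_eq_constantCoeff (localization a F) R _
      (fun i => A.constantCoeff_locForm R i) χ₁ hχ₁ hχ₁1 _ Φ₁ hΦ₁q hΦ₁m _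
  obtain ⟨v₀, hv₀⟩ := hχ1 w
  have hv₀1 : v₀.1 = 0 := Subtype.ext (funext fun i => by
    rw [← hχF, hv₀, hw i i.2]
    rfl)
  let D := ∏ i with i ∉ F ∧ (a *ᵥ w) i = 0, A.form R i
  have hΦu : ∀ i, Φ (invU a R i) = AddMonoidAlgebra.single 0 (A.form R i) := fun i => by
    have := hΦq (MvPolynomial.X i)
    rwa [MvPolynomial.aeval_X, MvPolynomial.aeval_X] at this
  have hwt₀ : negWeight (A.form R) (σ * χ v₀) = 1 := by
    refine Finset.prod_eq_one fun i _ => ?_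
    rw [hv₀, Pi.mul_apply, hσw, Int.toNat_of_nonpos (by simp), pow_zero]
  have hΦh : Φ (chartFn a R F w) = AddMonoidAlgebra.single v₀ D := by
    rw [chartFn, map_mul, map_prod, hΦm w v₀ hv₀, hwt₀]
    simp only [hΦu, AddMonoidAlgebra.prod_single, AddMonoidAlgebra.single_mul_single,
      Finset.sum_const_zero, add_zero, one_mul, D]
  have hDreg : D ∈ nonZeroDivisors _ :=
    Submonoid.prod_mem _ fun i _ => A.form_mem_nonZeroDivisors R hR i (ha i)
  have hDreg' : A.restrict R D ∈ nonZeroDivisors _ := by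
    rw [map_prod]
    refine Submonoid.prod_mem _ fun i hi => ?_
    exact A.restrict_form_mem_nonZeroDivisors R hR hF i (Finset.mem_filter.mp hi).2.1
  refine ⟨φ, hφinj, fun b => ?_, fun f => ⟨fun hf => ?_, fun hf => ?_⟩, ?_, ?_⟩
  -- Multiplication by the `N`-th power of `chartFn` shifts exponents by `N • v₀`. For large `N`
  -- this removes the divisibility condition at the `i ∉ F` with `(a *ᵥ w) i ≠ 0`; at the other
  -- `i ∉ F` the condition holds because of the factor `D ^ N`, and at `i ∈ F` because `b`
  -- satisfies it.
  · obtain ⟨N, hN⟩ : ∃ N : ℕ, ∀ u ∈ (Ω b).coeff.support, ∀ i, |χ u i| ≤ N := by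
      refine ⟨((Ω b).coeff.support ×ˢ Finset.univ).sup fun p => (χ p.1 p.2).natAbs,
        fun u hu i => ?_⟩
      have := Finset.le_sup (f := fun p : _ × Fin n => (χ p.1 p.2).natAbs)
        (Finset.mk_mem_product hu (Finset.mem_univ i))
      rw [Int.abs_eq_natAbs]
      exact_mod_cast this
    have hpow : Ω (φ (chartFn a R F w) ^ N * b) =
        AddMonoidAlgebra.single (N • v₀) (D ^ N) * Ω b := by
      rw [map_mul, map_pow, hφ, hΦh, AddMonoidAlgebra.single_pow]
    obtain ⟨f, hf⟩ := (hΦr (Ω (φ (chartFn a R F w) ^ N * b))).mpr fun u => by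
      rw [hpow, AddMonoidAlgebra.coeff_single_mul_apply]
      by_cases hu : (-(N • v₀) + u) ∈ (Ω b).coeff.support
      swap
      · rw [Finsupp.notMem_support_iff.mp hu, mul_zero]
        exact dvd_zero _
      rw [hwt, mul_comm]
      refine mul_dvd_mul ?_ ?_
      · have hD : D ^ N = ∏ i ∈ Fᶜ, (if (a *ᵥ w) i = 0 then A.form R i ^ N else 1) := by
          rw [← Finset.prod_pow, Finset.prod_ite, Finset.prod_const_one, mul_one]
          refine Finset.prod_congr ?_ fun _ _ => rfl
          ext i
          simp
        rw [hD]
        refine Finset.prod_dvd_prod_of_dvd _ _ fun i hi => ?_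
        have hN' := hN _ hu i
        have hχu : χ u i = N * (a *ᵥ w) i + χ (-(N • v₀) + u) i := by
          rw [map_add, map_neg, map_nsmul, hv₀]
          simp
        have hσi := hσw i
        split_ifs with h0
        · refine pow_dvd_pow _ ?_
          rw [hχu, h0, mul_zero, zero_add]
          rw [abs_le] at hN'
          rcases hσ i with h | h <;> rw [h] <;> omega
        · have h1 : 1 ≤ |(a *ᵥ w) i| := Int.one_le_abs h0
          have h2 : (0 : ℤ) ≤ σ i * χ u i := by
            rw [hχu, mul_add, mul_left_comm, hσi]
            have h3 : (N : ℤ) * 1 ≤ N * |(a *ᵥ w) i| := by gcongr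
            rw [abs_le] at hN'
            rcases hσ i with h | h <;> rw [h] <;> omega
          rw [Int.toNat_of_nonpos (by omega), pow_zero]
      · have h1 : (-(N • v₀) + u) = (u.1, (-(N • v₀) + u).2) :=
          Prod.ext (by simp [hv₀1]) rfl
        rw [h1]
        exact (hΩr _).mp ⟨b, rfl⟩ _ _
    exact ⟨N, f, hΩ (by rw [hφ, hf])⟩
  · have hlift : ∀ p ∈ Ideal.span (A.form R '' F), ∃ y ∈ vanishingIdeal a R F,
        Φ y = AddMonoidAlgebra.single 0 p := by
      intro p hp
      induction hp using Submodule.span_induction with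
      | mem p hp =>
        obtain ⟨i, hi, rfl⟩ := hp
        exact ⟨_, invU_mem_vanishingIdeal a R F i hi, hΦu i⟩
      | zero => exact ⟨0, Ideal.zero_mem _, by simp⟩
      | add p p' _ _ hp hp' =>
        obtain ⟨y, hy, h⟩ := hp
        obtain ⟨y', hy', h'⟩ := hp'
        exact ⟨y + y', Ideal.add_mem _ hy hy', by
          rw [map_add, h, h', AddMonoidAlgebra.single_add]⟩
      | smul s p _ hp =>
        obtain ⟨y, hy, h⟩ := hp
        obtain ⟨q, rfl⟩ := A.aeval_form_surjective R hR s
        exact ⟨MvPolynomial.aeval (invU a R) q * y, Ideal.mul_mem_left _ _ hy, by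
          rw [map_mul, hΦq, h, AddMonoidAlgebra.single_mul_single, zero_add, smul_eq_mul]⟩
    -- Each Laurent coefficient of `f` is treated separately: if its weight is nonzero on `F`, then
    -- the monomial lies in the ideal, otherwise the coefficient vanishes on `H_F`.
    have hmem : Φ f ∈ ((vanishingIdeal a R F).restrictScalars R).map Φ.toLinearMap := by
      refine AddMonoidAlgebra.mem_submodule_of_single _ _ fun v => ?_
      obtain ⟨p, hp⟩ := (hΦr (Φ f)).mp ⟨f, rfl⟩ v
      obtain ⟨w', hw'⟩ := hχ2 v
      rw [hp]
      by_cases hv : v.1 = 0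
      · have h1 : A.restrict R ((Φ f).coeff v) = 0 := by
          have := hcoeff (φ f) v.2
          rw [hf, hφ] at this
          have hv' : v = (0, v.2) := Prod.ext hv rfl
          rw [hv', ← this]
          simp
        rw [hp, map_mul] at h1
        have h2 : A.restrict R (negWeight (A.form R) (σ * χ v)) ∈ nonZeroDivisors _ := by
          rw [hwt, hv, map_zero]
          simp only [mul_zero, negWeight, Pi.zero_apply, neg_zero, Int.toNat_zero, pow_zero,
            Finset.prod_const_one, map_one, one_mul, map_prod, map_pow]
          exact Submonoid.prod_mem _ fun i hi => Submonoid.pow_mem _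
            (A.restrict_form_mem_nonZeroDivisors R hR hF i (Finset.mem_compl.mp hi)) _
        obtain ⟨y, hy, hyp⟩ := hlift p (A.mem_span_form_of_restrict_eq_zero R hR p
          ((mul_left_mem_nonZeroDivisors_eq_zero_iff h2).mp h1))
        refine ⟨y * invMono a R w', Ideal.mul_mem_right _ _ hy, ?_⟩
        rw [AlgHom.toLinearMap_apply, map_mul, hyp, hΦm w' v hw',
          AddMonoidAlgebra.single_mul_single, zero_add, mul_comm]
      · obtain ⟨i, hi⟩ := Function.ne_iff.mp (fun h => hv (Subtype.ext h) : v.1.1 ≠ 0)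
        have hi' : (a *ᵥ w') i ≠ 0 := by
          rw [← hw', hχF]
          exact hi
        obtain ⟨q, rfl⟩ := A.aeval_form_surjective R hR p
        refine ⟨MvPolynomial.aeval (invU a R) q * invMono a R w', Ideal.mul_mem_left _ _
          (invMono_mem_vanishingIdeal a R F w' i i.2 hi'), ?_⟩
        rw [AlgHom.toLinearMap_apply, map_mul, hΦq, hΦm w' v hw',
          AddMonoidAlgebra.single_mul_single, zero_add, mul_comm]
    obtain ⟨y, hy, hyf⟩ := hmem
    rwa [← hΦinj hyf]
  · have hle : vanishingIdeal a R F ≤ RingHom.ker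
        ((torusEval A.m (evalOrigin (localization a F) R).toRingHom).comp φ.toRingHom) := by
      rw [vanishingIdeal_eq_span, Ideal.span_le]
      rintro _ (⟨i, hi, rfl⟩ | ⟨w', ⟨i, hi, hwi⟩, rfl⟩)
      · change torusEval _ _ (φ _) = 0
        ext l : 2
        rw [hcoeff, hφ, hΦu, AddMonoidAlgebra.coeff_single, Finsupp.single_apply]
        split_ifs
        · exact A.restrict_form_of_mem R i hi
        · exact map_zero _
      · change torusEval _ _ (φ _) = 0
        obtain ⟨v, hv⟩ := hχ1 w'
        ext l : 2
        rw [hcoeff, hφ, hΦm w' v hv, AddMonoidAlgebra.coeff_single, Finsupp.single_apply, if_neg]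
        · exact map_zero _
        · rintro rfl
          apply hwi
          rw [← hv]
          exact hχF (0, l) ⟨i, hi⟩
    exact hle hf
  · refine mem_nonZeroDivisors_of_injective (f := Ω) hΩ ?_
    rw [hφ, hΦh]
    exact AddMonoidAlgebra.single_mem_nonZeroDivisors _ _ hDreg
  · have h1 : torusEval A.m (evalOrigin (localization a F) R).toRingHom
        (φ (chartFn a R F w)) = AddMonoidAlgebra.single v₀.2 (A.restrict R D) := by
      ext l : 2
      rw [hcoeff, hφ, hΦh, AddMonoidAlgebra.coeff_single, AddMonoidAlgebra.coeff_single,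
        Finsupp.single_apply, Finsupp.single_apply]
      have h2 : v₀ = (0, l) ↔ v₀.2 = l :=
        ⟨fun h => by rw [h], fun h => Prod.ext hv₀1 h⟩
      simp only [h2]
      split_ifs
      · rfl
      · exact map_zero _
    rw [h1]
    exact AddMonoidAlgebra.single_mem_nonZeroDivisors _ _ hDreg'

end AdaptedBasis

/-! ### From rings to schemes -/

section Torus

variable (m : ℕ) (S : Type u) [CommRing S]

/-- The inclusion of the functions on `X × 𝔸^m × 𝔸^m` into the functions on `X × 𝔸^m × 𝔾_m^m`,
for `X = Spec S`. -/
def torusIncl : MvPolynomial (Fin m ⊕ Fin m) S →+* TorusRing m S :=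
  MvPolynomial.eval₂Hom (AddMonoidAlgebra.singleZeroRingHom.comp MvPolynomial.C)
    (Sum.elim (fun j => AddMonoidAlgebra.single 0 (MvPolynomial.X j))
      (fun j => AddMonoidAlgebra.single (Pi.single j 1) 1))

/-- The product of the coordinates of the factor `𝔾_m^m`. -/
def torusDenom : MvPolynomial (Fin m ⊕ Fin m) S := ∏ j, MvPolynomial.X (Sum.inr j)

variable {S}

lemma torusIncl_C (c : S) :
    torusIncl m S (MvPolynomial.C c) = AddMonoidAlgebra.single 0 (MvPolynomial.C c) := by
  simp [torusIncl]

lemma torusIncl_X_inl (j : Fin m) :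
    torusIncl m S (MvPolynomial.X (Sum.inl j)) =
      AddMonoidAlgebra.single 0 (MvPolynomial.X j) := by
  simp [torusIncl]

lemma torusIncl_X_inr (j : Fin m) :
    torusIncl m S (MvPolynomial.X (Sum.inr j)) =
      AddMonoidAlgebra.single (Pi.single j 1) 1 := by
  simp [torusIncl]

lemma torusIncl_prod_inl (k : Fin m → ℕ) :
    torusIncl m S (∏ j, MvPolynomial.X (Sum.inl j) ^ k j) =
      AddMonoidAlgebra.single 0 (∏ j, MvPolynomial.X j ^ k j) := by
  simp only [map_prod, map_pow, torusIncl_X_inl, AddMonoidAlgebra.single_pow, smul_zero,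
    AddMonoidAlgebra.prod_single, Finset.sum_const_zero]

lemma torusIncl_prod_inr (l : Fin m → ℕ) :
    torusIncl m S (∏ j, MvPolynomial.X (Sum.inr j) ^ l j) =
      AddMonoidAlgebra.single (fun j => (l j : ℤ)) 1 := by
  simp only [map_prod, map_pow, torusIncl_X_inr, AddMonoidAlgebra.single_pow, one_pow,
    AddMonoidAlgebra.prod_single, Finset.prod_const_one]
  congr 1
  ext j
  simp [Finset.sum_apply, Pi.single_apply]

lemma torusIncl_monomial (k : Fin m ⊕ Fin m →₀ ℕ) (c : S) :
    torusIncl m S (MvPolynomial.monomial k c) =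
      AddMonoidAlgebra.single (fun j => (k (Sum.inr j) : ℤ))
        (MvPolynomial.monomial (Finsupp.equivFunOnFinite.symm fun j => k (Sum.inl j)) c) := by
  have h1 : MvPolynomial.monomial k c = MvPolynomial.C c *
      ((∏ j, MvPolynomial.X (Sum.inl j) ^ k (Sum.inl j)) *
        ∏ j, MvPolynomial.X (Sum.inr j) ^ k (Sum.inr j)) := by
    rw [MvPolynomial.monomial_eq, Finsupp.prod_fintype _ _ (by simp), Fintype.prod_sum_type]
  have h2 : MvPolynomial.monomial (Finsupp.equivFunOnFinite.symm fun j => k (Sum.inl j)) c =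
      MvPolynomial.C c * ∏ j, MvPolynomial.X j ^ k (Sum.inl j) := by
    rw [MvPolynomial.monomial_eq, Finsupp.prod_fintype _ _ (by simp)]
    rfl
  rw [h1, map_mul, map_mul, torusIncl_prod_inl m (fun j => k (Sum.inl j)),
    torusIncl_prod_inr m (fun j => k (Sum.inr j)), torusIncl_C, h2,
    AddMonoidAlgebra.single_mul_single, AddMonoidAlgebra.single_mul_single]
  simp

lemma coeff_torusIncl (p : MvPolynomial (Fin m ⊕ Fin m) S) (k : Fin m ⊕ Fin m →₀ ℕ) :
    ((torusIncl m S p).coeff fun j => (k (Sum.inr j) : ℤ)).coeff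
      (Finsupp.equivFunOnFinite.symm fun j => k (Sum.inl j)) = p.coeff k := by
  classical
  induction p using MvPolynomial.induction_on' with
  | add p q hp hq => simp only [map_add, AddMonoidAlgebra.coeff_add, Finsupp.add_apply,
      MvPolynomial.coeff_add, hp, hq]
  | monomial k' c =>
    rw [torusIncl_monomial, AddMonoidAlgebra.coeff_single, Finsupp.single_apply,
      MvPolynomial.coeff_monomial]
    have h : k' = k ↔ (fun j => (k' (Sum.inr j) : ℤ)) = (fun j => (k (Sum.inr j) : ℤ)) ∧
        (Finsupp.equivFunOnFinite.symm fun j => k' (Sum.inl j)) =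
          (Finsupp.equivFunOnFinite.symm fun j => k (Sum.inl j)) := by
      constructor
      · rintro rfl
        exact ⟨rfl, rfl⟩
      · rintro ⟨h1, h2⟩
        ext (j | j)
        · exact congrFun (Finsupp.equivFunOnFinite.symm.injective h2) j
        · exact_mod_cast congrFun h1 j
    by_cases h1 : (fun j => (k' (Sum.inr j) : ℤ)) = (fun j => (k (Sum.inr j) : ℤ))
    · rw [if_pos h1, MvPolynomial.coeff_monomial]
      exact if_congr (by rw [h]; exact ⟨fun h => ⟨h1, h⟩, fun h => h.2⟩) rfl rfl
    · rw [if_neg h1, if_neg (fun h' => h1 (h.mp h').1), MvPolynomial.coeff_zero]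

lemma torusIncl_injective : Function.Injective (torusIncl m S) := by
  rw [injective_iff_map_eq_zero]
  intro p hp
  ext k
  rw [← coeff_torusIncl, hp]
  simp

lemma torusIncl_torusDenom_pow (N : ℕ) :
    torusIncl m S (torusDenom m S) ^ N = AddMonoidAlgebra.single (fun _ => (N : ℤ)) 1 := by
  have h := torusIncl_prod_inr (S := S) m fun _ => N
  rwa [Finset.prod_pow, map_pow] at h

lemma isUnit_torusIncl_torusDenom : IsUnit (torusIncl m S (torusDenom m S)) := by
  have h := torusIncl_torusDenom_pow (S := S) m 1
  rw [pow_one] at h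
  refine IsUnit.of_mul_eq_one (AddMonoidAlgebra.single (fun _ => (-1 : ℤ)) 1) ?_
  rw [h, AddMonoidAlgebra.single_mul_single, mul_one, AddMonoidAlgebra.one_def]
  congr 1

lemma exists_torusIncl_eq (b : TorusRing m S) :
    ∃ N p, torusIncl m S p = torusIncl m S (torusDenom m S) ^ N * b := by
  induction b using AddMonoidAlgebra.induction_linear with
  | zero => exact ⟨0, 0, by simp⟩
  | add b b' hb hb' =>
    obtain ⟨N, p, hp⟩ := hb
    obtain ⟨N', p', hp'⟩ := hb'
    refine ⟨N + N', torusDenom m S ^ N' * p + torusDenom m S ^ N * p', ?_⟩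
    rw [map_add, map_mul, map_mul, hp, hp', map_pow, map_pow]
    ring
  | single l q =>
    induction q using MvPolynomial.induction_on' with
    | add p q hp hq =>
      obtain ⟨N, p', hp⟩ := hp
      obtain ⟨N', q', hq⟩ := hq
      refine ⟨N + N', torusDenom m S ^ N' * p' + torusDenom m S ^ N * q', ?_⟩
      rw [map_add, map_mul, map_mul, hp, hq, map_pow, map_pow, AddMonoidAlgebra.single_add]
      ring
    | monomial k c =>
      refine ⟨∑ j, (l j).natAbs, MvPolynomial.monomial (Finsupp.equivFunOnFinite.symm
        (Sum.elim k fun j => (((∑ j, (l j).natAbs : ℕ) : ℤ) + l j).toNat)) c, ?_⟩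
      rw [torusIncl_monomial, torusIncl_torusDenom_pow, AddMonoidAlgebra.single_mul_single,
        one_mul]
      congr 1
      · ext j
        have h : (l j).natAbs ≤ ∑ j, (l j).natAbs :=
          Finset.single_le_sum (f := fun j => (l j).natAbs) (fun _ _ => Nat.zero_le _)
            (Finset.mem_univ j)
        simp only [Finsupp.equivFunOnFinite_symm_apply_apply, Sum.elim_inr, Pi.add_apply]
        omega
      · refine congrArg (fun k => MvPolynomial.monomial k c) ?_
        ext j
        rfl

lemma torusEval_torusIncl {R : Type u} [CommRing R] (x : S →+* R)
    (p : MvPolynomial (Fin m ⊕ Fin m) S) :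
    torusEval m x (torusIncl m S p) = torusIncl m R (MvPolynomial.map x p) := by
  have h : (torusEval m x).comp (torusIncl m S) = (torusIncl m R).comp (MvPolynomial.map x) := by
    refine MvPolynomial.ringHom_ext (fun c => ?_) ?_
    · simp [torusIncl_C, torusEval]
    · rintro (j | j)
      · simp [torusIncl_X_inl, torusEval]
      · simp [torusIncl_X_inr, torusEval]
  exact RingHom.congr_fun h p

lemma torusEval_surjective {R : Type u} [CommRing R] {x : S →+* R}
    (hx : Function.Surjective x) : Function.Surjective (torusEval m x) :=
  AddMonoidAlgebra.map_surjective _ (MvPolynomial.map_surjective x hx)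

end Torus

section Away

/-- A ring homomorphism `A → B` that is the localization of `A` at `h`, up to powers of `h`,
corresponds to an open immersion onto the locus `h ≠ 0`. -/
lemma isOpenImmersion_SpecMap {A B : Type u} [CommRing A] [CommRing B] (f : A →+* B) (h : A)
    (hu : IsUnit (f h)) (hs : ∀ b, ∃ N a, f a = f h ^ N * b)
    (hk : ∀ a, f a = 0 → ∃ N, h ^ N * a = 0) :
    IsOpenImmersion (Spec.map (CommRingCat.ofHom f)) ∧
      Set.range (Spec.map (CommRingCat.ofHom f)) =
        (PrimeSpectrum.basicOpen h : Set (PrimeSpectrum A)) := by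
  algebraize [f]
  have : IsLocalization.Away h B := by
    refine (isLocalization_iff _ _).mpr ⟨?_, ?_, ?_⟩
    · rintro ⟨_, N, rfl⟩
      have h1 := hu.pow N
      rwa [← map_pow] at h1
    · intro b
      obtain ⟨N, a, ha⟩ := hs b
      exact ⟨⟨a, ⟨h ^ N, N, rfl⟩⟩, by
        change b * f (h ^ N) = f a
        rw [ha, map_pow, mul_comm]⟩
    · intro a a' haa
      obtain ⟨N, hN⟩ := hk (a - a') (by rw [map_sub]; exact sub_eq_zero.mpr haa)
      exact ⟨⟨h ^ N, N, rfl⟩, by rwa [mul_sub, sub_eq_zero] at hN⟩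
  exact ⟨IsOpenImmersion.of_isLocalization h, PrimeSpectrum.localization_away_comap_range B h⟩

lemma isDominant_SpecMap {A B : Type u} [CommRing A] [CommRing B] (f : A →+* B)
    (hf : Function.Injective f) : IsDominant (Spec.map (CommRingCat.ofHom f)) := by
  refine ⟨(PrimeSpectrum.denseRange_comap_iff_ker_le_nilRadical f).mpr ?_⟩
  rw [(RingHom.injective_iff_ker_eq_bot f).mp hf]
  exact bot_le

/-- A square of rings `A → B`, `A → A/I → C` with `B → C` surjective and with kernel generated
by `I` is a pushout. -/
lemma isPushout_of_ker_le_map {A B C : Type u} [CommRing A] [CommRing B] [CommRing C]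
    (I : Ideal A) (f : A →+* B) (p : A ⧸ I →+* C) (q : B →+* C)
    (hq : Function.Surjective q) (hpq : p.comp (Ideal.Quotient.mk I) = q.comp f)
    (hk : RingHom.ker q ≤ I.map f) :
    IsPushout (CommRingCat.ofHom f) (CommRingCat.ofHom (Ideal.Quotient.mk I))
      (CommRingCat.ofHom q) (CommRingCat.ofHom p) := by
  refine ⟨⟨?_⟩, ⟨Limits.PushoutCocone.IsColimit.mk _ (fun s => CommRingCat.ofHom
    (RingHom.liftOfSurjective q hq ⟨s.inl.hom, ?_⟩)) ?_ ?_ ?_⟩⟩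
  · rw [← CommRingCat.ofHom_comp, ← CommRingCat.ofHom_comp, hpq]
  · refine hk.trans (Ideal.map_le_iff_le_comap.mpr fun i hi => ?_)
    have h := RingHom.congr_fun (congrArg CommRingCat.Hom.hom s.condition) i
    simp only [CommRingCat.hom_comp, CommRingCat.hom_ofHom, RingHom.comp_apply,
      Ideal.Quotient.eq_zero_iff_mem.mpr hi, map_zero] at h
    exact h
  · intro s
    ext b
    exact RingHom.liftOfRightInverse_comp_apply q _ (Function.rightInverse_surjInv hq) _ b
  · intro s
    ext a
    have h1 := RingHom.congr_fun hpq a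
    have h2 := RingHom.congr_fun (congrArg CommRingCat.Hom.hom s.condition) a
    simp only [CommRingCat.hom_comp, CommRingCat.hom_ofHom, RingHom.comp_apply] at h1 h2 ⊢
    rw [h1, ← h2]
    exact RingHom.liftOfRightInverse_comp_apply q _ (Function.rightInverse_surjInv hq) _ _
  · intro s t h1 h2
    ext c
    obtain ⟨b, rfl⟩ := hq c
    have h3 := RingHom.congr_fun (congrArg CommRingCat.Hom.hom h1) b
    refine h3.trans ?_
    exact (RingHom.liftOfRightInverse_comp_apply q _ (Function.rightInverse_surjInv hq)
      ⟨s.inl.hom, _⟩ b).symm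

end Away

/-! ### Open subschemes of a product with an affine space -/

section AffineChart

variable (m : ℕ) {S : Type u} [CommRing S]

/-- A bijection of the coordinates of `𝔸^{2m}` with those of `𝔸^m × 𝔸^m`. -/
def coordEquiv : ULift.{u} (Fin (2 * m)) ≃ Fin m ⊕ Fin m :=
  Equiv.ulift.trans ((finCongr (two_mul m)).trans finSumFinEquiv.symm)

/-- The polynomial functions on `X × 𝔸^{2m}` for `X = Spec S`, restricted to the locus `h ≠ 0` in
`X × 𝔸^m × 𝔾_m^m`. -/
def affineChartHom (h : TorusRing m S) :
    MvPolynomial (ULift.{u} (Fin (2 * m))) S →+* Localization.Away h :=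
  (algebraMap (TorusRing m S) (Localization.Away h)).comp
    ((torusIncl m S).comp (MvPolynomial.renameEquiv S (coordEquiv m)).toRingEquiv.toRingHom)

/-- The inclusion of the locus `h ≠ 0` in `X × 𝔸^m × 𝔾_m^m` into `X × 𝔸^{2m}`. -/
def affineChart (h : TorusRing m S) :
    Spec (CommRingCat.of (Localization.Away h)) ⟶ AffSp (2 * m) (Spec (CommRingCat.of S)) :=
  Spec.map (CommRingCat.ofHom (affineChartHom m h)) ≫
    (AffineSpace.SpecIso (ULift.{u} (Fin (2 * m))) (CommRingCat.of S)).inv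

instance (h : TorusRing m S) : IsOpenImmersion (affineChart m h) := by
  have h1 : IsOpenImmersion (Spec.map (CommRingCat.ofHom
      (algebraMap (TorusRing m S) (Localization.Away h)))) :=
    IsOpenImmersion.of_isLocalization h
  have h2 := (isOpenImmersion_SpecMap (torusIncl m S) (torusDenom m S)
    (isUnit_torusIncl_torusDenom m) (exists_torusIncl_eq m) fun p hp =>
      ⟨0, by rw [torusIncl_injective m (hp.trans (map_zero _).symm), mul_zero]⟩).1
  have h3 : IsOpenImmersion (Spec.map (CommRingCat.ofHom
      (MvPolynomial.renameEquiv S (coordEquiv.{u} m)).toRingEquiv.toRingHom)) :=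
    inferInstanceAs (IsOpenImmersion (Spec.map
      (MvPolynomial.renameEquiv S (coordEquiv.{u} m)).toRingEquiv.toCommRingCatIso.hom))
  rw [affineChart, affineChartHom, CommRingCat.ofHom_comp, CommRingCat.ofHom_comp, Spec.map_comp,
    Spec.map_comp]
  infer_instance

lemma isDominant_affineChart {h : TorusRing m S} (hh : h ∈ nonZeroDivisors (TorusRing m S)) :
    IsDominant (affineChart m h) := by
  have h1 : IsDominant (Spec.map (CommRingCat.ofHom (affineChartHom m h))) := by
    refine isDominant_SpecMap _ ?_
    refine (IsLocalization.injective (M := Submonoid.powers h) _ ?_).comp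
      ((torusIncl_injective m).comp (MvPolynomial.renameEquiv S (coordEquiv m)).injective)
    rintro _ ⟨N, rfl⟩
    exact pow_mem hh N
  rw [affineChart]
  infer_instance

lemma affineChartHom_C (h : TorusRing m S) (c : S) :
    affineChartHom m h (MvPolynomial.C c) =
      algebraMap _ _ (AddMonoidAlgebra.single 0 (MvPolynomial.C c) : TorusRing m S) := by
  rw [← torusIncl_C]
  simp [affineChartHom]

lemma affineChart_over (h : TorusRing m S) :
    affineChart m h ≫ (AffSp (2 * m) (Spec (CommRingCat.of S)) ↘ Spec (CommRingCat.of S)) =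
      Spec.map (CommRingCat.ofHom ((affineChartHom m h).comp MvPolynomial.C)) := by
  rw [affineChart, Category.assoc, AffineSpace.SpecIso_inv_over, ← Spec.map_comp]
  rfl

lemma affineChart_base_change {R : Type u} [CommRing R] (x : S →+* R) (h : TorusRing m S) :
    Spec.map (CommRingCat.ofHom (Localization.awayMap (torusEval m x) h)) ≫ affineChart m h =
      affineChart m (torusEval m x h) ≫
        AffineSpace.map _ (Spec.map (CommRingCat.ofHom x)) := by
  rw [AffineSpace.map_SpecMap, affineChart, affineChart, Category.assoc, Iso.inv_hom_id_assoc,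
    ← Category.assoc, ← Category.assoc, ← Spec.map_comp, ← Spec.map_comp,
    ← CommRingCat.ofHom_comp, ← CommRingCat.ofHom_comp]
  congr 3
  refine RingHom.ext fun p => ?_
  change Localization.awayMap (torusEval m x) h (algebraMap _ _ (torusIncl m S
    (MvPolynomial.rename (coordEquiv m) p))) = algebraMap _ _ (torusIncl m R
    (MvPolynomial.rename (coordEquiv m) (MvPolynomial.map x p)))
  rw [Localization.awayMap, IsLocalization.Away.map, IsLocalization.map_eq, torusEval_torusIncl,
    MvPolynomial.map_rename]

end AffineChart

/-- The geometric form of a chart: an isomorphism, up to inverting `h`, of `A` with the functions on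
`X × 𝔸^m × 𝔾_m^m` that identifies the ideal `I` with the ideal of `{x} × 𝔸^m × 𝔾_m^m` gives an open
subset `U` of `Spec A` and an open immersion of `U` into `X × 𝔸^{2m}`, restricting to one of
`U ∩ V(I)` into `{x} × 𝔸^{2m}`. -/
theorem exists_schemeChart {R A S : Type u} [CommRing R] [CommRing A] [CommRing S] [Algebra R A]
    [Algebra R S] (x : S →ₐ[R] R) (I : Ideal A) (h : A) (m : ℕ) (φ : A →ₐ[R] TorusRing m S)
    (hinj : Function.Injective φ) (hsurj : ∀ b, ∃ N f, φ f = φ h ^ N * b)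
    (hI : ∀ f, torusEval m x.toRingHom (φ f) = 0 ↔ f ∈ I)
    (hnzd : φ h ∈ nonZeroDivisors (TorusRing m S))
    (hnzd' : torusEval m x.toRingHom (φ h) ∈ nonZeroDivisors (TorusRing m R)) :
    ∃ (U V : Scheme.{u}) (f : U ⟶ Spec (CommRingCat.of A))
      (g : U ⟶ AffSp (2 * m) (Spec (CommRingCat.of S))) (j : V ⟶ U)
      (p : V ⟶ Spec (CommRingCat.of (A ⧸ I)))
      (k : V ⟶ AffSp (2 * m) (Spec (CommRingCat.of R))),
      IsOpenImmersion f ∧ Set.range f = (PrimeSpectrum.basicOpen h : Set (PrimeSpectrum A)) ∧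
      IsOpenImmersion g ∧ IsDominant g ∧
      g ≫ (AffSp (2 * m) (Spec (CommRingCat.of S)) ↘ Spec (CommRingCat.of S)) ≫
        Spec.map (CommRingCat.ofHom (algebraMap R S)) =
          f ≫ Spec.map (CommRingCat.ofHom (algebraMap R A)) ∧
      IsPullback j p f (Spec.map (CommRingCat.ofHom (Ideal.Quotient.mk I))) ∧
      IsOpenImmersion k ∧ IsDominant k ∧
      j ≫ g = k ≫ AffineSpace.map _ (Spec.map (CommRingCat.ofHom x.toRingHom)) ∧
      k ≫ (AffSp (2 * m) (Spec (CommRingCat.of R)) ↘ Spec (CommRingCat.of R)) =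
        p ≫ Spec.map (CommRingCat.ofHom (algebraMap R (A ⧸ I))) := by
  set q := torusEval m x.toRingHom with hq
  have hBinj : Function.Injective (algebraMap (TorusRing m S) (Localization.Away (φ h))) := by
    refine IsLocalization.injective (M := Submonoid.powers (φ h)) _ ?_
    rintro _ ⟨N, rfl⟩
    exact pow_mem hnzd N
  have hCinj : Function.Injective (algebraMap (TorusRing m R) (Localization.Away (q (φ h)))) := by
    refine IsLocalization.injective (M := Submonoid.powers (q (φ h))) _ ?_
    rintro _ ⟨N, rfl⟩
    exact pow_mem hnzd' N
  have hunit : IsUnit (algebraMap (TorusRing m S) (Localization.Away (φ h)) (φ h)) :=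
    IsLocalization.Away.algebraMap_isUnit _
  let fr : A →+* Localization.Away (φ h) := (algebraMap _ _).comp φ.toRingHom
  have hfr : ∀ y, fr y = algebraMap _ _ (φ y) := fun y => rfl
  have hqs : Function.Surjective q := by
    refine torusEval_surjective m fun r => ⟨algebraMap R S r, ?_⟩
    exact x.commutes r
  let pr : A ⧸ I →+* Localization.Away (q (φ h)) :=
    Ideal.Quotient.lift I ((algebraMap _ _).comp (q.comp φ.toRingHom)) fun y hy => by
      change algebraMap (TorusRing m R) (Localization.Away (q (φ h))) (q (φ y)) = 0
      rw [(hI y).mpr hy, map_zero]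
  have hmap : ∀ b, Localization.awayMap q (φ h) (algebraMap _ _ b) = algebraMap _ _ (q b) := by
    intro b
    rw [Localization.awayMap, IsLocalization.Away.map, IsLocalization.map_eq]
  have hpow : ∀ b, ∃ N y, fr y = fr h ^ N * b := by
    intro b
    obtain ⟨⟨b', ⟨_, N, rfl⟩⟩, hb⟩ := IsLocalization.surj (.powers (φ h)) b
    obtain ⟨M, y, hy⟩ := hsurj b'
    refine ⟨M + N, y, ?_⟩
    rw [hfr, hfr, hy, map_mul, ← hb, map_pow, map_pow]
    ring
  have hf := isOpenImmersion_SpecMap fr h hunit hpow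
    (fun y hy => ⟨0, by rw [hinj (hBinj (hy.trans ((map_zero _).symm.trans
      (congrArg _ (map_zero φ).symm)))), mul_zero]⟩)
  refine ⟨_, _, Spec.map (CommRingCat.ofHom fr), affineChart m (φ h),
    Spec.map (CommRingCat.ofHom (Localization.awayMap q (φ h))),
    Spec.map (CommRingCat.ofHom pr), affineChart m (q (φ h)), hf.1, hf.2, inferInstance,
    isDominant_affineChart m hnzd, ?_, ?_, inferInstance, isDominant_affineChart m hnzd',
    affineChart_base_change m _ _, ?_⟩
  · rw [← Category.assoc, affineChart_over, ← Spec.map_comp, ← Spec.map_comp,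
      ← CommRingCat.ofHom_comp, ← CommRingCat.ofHom_comp]
    congr 2
    ext r
    change affineChartHom m (φ h) (MvPolynomial.C (algebraMap R S r)) =
      algebraMap _ _ (φ (algebraMap R A r))
    rw [affineChartHom_C, AlgHom.commutes]
    rfl
  · refine isPullback_SpecMap_of_isPushout _ _ _ _ (isPushout_of_ker_le_map I fr pr _ ?_ ?_ ?_)
    · rw [Localization.awayMap_surjective_iff]
      intro c
      obtain ⟨b, rfl⟩ := hqs c
      exact ⟨b, 0, by simp⟩
    · ext y
      exact (hmap (φ y)).symm
    · intro y hy
      obtain ⟨N, a, ha⟩ := hpow y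
      have haI : a ∈ I := by
        refine (hI a).mp (hCinj ?_)
        rw [← hmap, ← hfr, ha, map_mul, (RingHom.mem_ker).mp hy, mul_zero, map_zero]
      rw [← Ideal.unit_mul_mem_iff_mem _ (hunit.pow N), ← hfr, ← ha]
      exact Ideal.mem_map_of_mem _ haI
  · rw [affineChart_over, ← Spec.map_comp, ← CommRingCat.ofHom_comp]
    congr 2
    ext r
    change affineChartHom m (q (φ h)) (MvPolynomial.C r) =
      algebraMap _ _ (q (φ (algebraMap R A r)))
    rw [affineChartHom_C, AlgHom.commutes]
    congr 1
    change _ = q (AddMonoidAlgebra.single 0 (MvPolynomial.C (algebraMap R S r)))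
    rw [hq, torusEval, AddMonoidAlgebra.mapRingHom_single, MvPolynomial.map_C]
    congr 2
    exact (x.commutes r).symm

/-! ### The flat of a point -/

section Partition

variable {n d : ℕ} (a : Matrix (Fin n) (Fin d) ℤ) (R : Type u) [CommRing R]

lemma vanishingIdeal_singleton_le_iff (p : Ideal (invariants a R)) (i : Fin n) :
    vanishingIdeal a R {i} ≤ p ↔
      invU a R i ∈ p ∧ ∀ w, (a *ᵥ w) i ≠ 0 → invMono a R w ∈ p := by
  rw [vanishingIdeal_eq_span, Ideal.span_le, Set.union_subset_iff]
  refine and_congr (by simp) ⟨fun h w hw => h ⟨w, ⟨i, by simp, hw⟩, rfl⟩, ?_⟩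
  rintro h _ ⟨w, ⟨j, hj, hw⟩, rfl⟩
  rw [Finset.mem_singleton] at hj
  exact h w (hj ▸ hw)

lemma vanishingIdeal_le_iff (p : Ideal (invariants a R)) (F : Finset (Fin n)) :
    vanishingIdeal a R F ≤ p ↔ ∀ i ∈ F, vanishingIdeal a R {i} ≤ p := by
  simp only [vanishingIdeal_singleton_le_iff]
  rw [vanishingIdeal_eq_span, Ideal.span_le, Set.union_subset_iff]
  constructor
  · intro h i hi
    exact ⟨h.1 ⟨i, hi, rfl⟩, fun w hw => h.2 ⟨w, ⟨i, hi, hw⟩, rfl⟩⟩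
  · intro h
    refine ⟨?_, ?_⟩
    · rintro _ ⟨i, hi, rfl⟩
      exact (h i hi).1
    · rintro _ ⟨w, ⟨i, hi, hw⟩, rfl⟩
      exact (h i hi).2 w hw

/-- The indices `i` such that the equations `z_i = w_i = 0` hold at the point `p` of `𝔐(𝒜)`. -/
def zeroSet (p : Ideal (invariants a R)) : Finset (Fin n) :=
  by classical exact {i | vanishingIdeal a R {i} ≤ p}

variable {a R}

lemma mem_zeroSet {p : Ideal (invariants a R)} {i : Fin n} :
    i ∈ zeroSet a R p ↔ vanishingIdeal a R {i} ≤ p := by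
  simp [zeroSet]

/-- If neither of two monomials vanishes at `p`, then their weights do not have opposite signs at an
index `i` where the product `z_i w_i` vanishes, since otherwise their product would be divisible by
`z_i w_i`. -/
lemma invMono_add_notMem {p : Ideal (invariants a R)} (hp : p.IsPrime) {w w' : Fin d → ℤ}
    (hw : invMono a R w ∉ p) (hw' : invMono a R w' ∉ p) :
    invMono a R (w + w') ∉ p ∧
      ∀ i, invU a R i ∈ p → (a *ᵥ (w + w')) i = 0 → (a *ᵥ w) i = 0 ∧ (a *ᵥ w') i = 0 := by
  have h : invMono a R w * invMono a R w' ∉ p := fun h => (hp.mem_or_mem h).elim hw hw'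
  rw [invMono_mul] at h
  refine ⟨fun h' => h (p.mul_mem_left _ h'), fun i hi h0 => ?_⟩
  have h1 : min (((a *ᵥ w) i).toNat + ((a *ᵥ w') i).toNat)
      ((-(a *ᵥ w) i).toNat + (-(a *ᵥ w') i).toNat) = 0 := by
    by_contra hne
    refine h (p.mul_mem_right _ (Ideal.mem_of_dvd p (Finset.dvd_prod_of_mem _ (Finset.mem_univ i))
      (p.pow_mem_of_mem hi _ (Nat.pos_of_ne_zero hne))))
  rw [mulVec_add, Pi.add_apply] at h0
  omega

/-- Some monomial that does not vanish at `p` has nonzero weight at all indices `i` at which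
`z_i w_i = 0`, but not `z_i = w_i = 0`, at `p`. -/
lemma exists_invMono_notMem {p : Ideal (invariants a R)} (hp : p.IsPrime) :
    ∃ w, invMono a R w ∉ p ∧
      ∀ i, invU a R i ∈ p → i ∉ zeroSet a R p → (a *ᵥ w) i ≠ 0 := by
  classical
  suffices h : ∀ T : Finset (Fin n), ∃ w, invMono a R w ∉ p ∧
      ∀ i ∈ T, invU a R i ∈ p → i ∉ zeroSet a R p → (a *ᵥ w) i ≠ 0 by
    obtain ⟨w, hw, h⟩ := h Finset.univ
    exact ⟨w, hw, fun i => h i (Finset.mem_univ i)⟩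
  intro T
  induction T using Finset.induction_on with
  | empty =>
    refine ⟨0, ?_, by simp⟩
    rw [invMono_zero]
    exact (Ideal.ne_top_iff_one p).mp hp.ne_top
  | insert j T _ ih =>
    obtain ⟨w, hw, h⟩ := ih
    by_cases hj : invU a R j ∈ p ∧ j ∉ zeroSet a R p
    · obtain ⟨w', hw', h'⟩ : ∃ w', (a *ᵥ w') j ≠ 0 ∧ invMono a R w' ∉ p := by
        by_contra! hcon
        exact hj.2 (mem_zeroSet.mpr ((vanishingIdeal_singleton_le_iff a R p j).mpr ⟨hj.1, hcon⟩))
      obtain ⟨h1, h2⟩ := invMono_add_notMem hp hw h'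
      refine ⟨w + w', h1, fun i hi hi1 hi2 h0 => ?_⟩
      rcases Finset.mem_insert.mp hi with rfl | hi
      · exact hw' (h2 i hi1 h0).2
      · exact h i hi hi1 hi2 (h2 i hi1 h0).1
    · refine ⟨w, hw, fun i hi hi1 hi2 => ?_⟩
      rcases Finset.mem_insert.mp hi with rfl | hi
      · exact absurd ⟨hi1, hi2⟩ hj
      · exact h i hi hi1 hi2

lemma mulVec_eq_zero_of_mem_zeroSet {p : Ideal (invariants a R)} {w : Fin d → ℤ}
    (hw : invMono a R w ∉ p) {i : Fin n} (hi : i ∈ zeroSet a R p) : (a *ᵥ w) i = 0 := by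
  by_contra h
  exact hw (((vanishingIdeal_singleton_le_iff a R p i).mp (mem_zeroSet.mp hi)).2 w h)

/-- The indices `i` with `z_i = w_i = 0` at a given point form a flat, because the functions
`z_i w_i` and the weights of the nonvanishing monomials satisfy the linear relations between the
`a_i`, up to inverting minors. -/
lemma isFlat_zeroSet (hrank : rank a = d)
    (hR : ∀ t : Fin d → Fin n, (a.submatrix t id).det ≠ 0 →
      IsUnit (((a.submatrix t id).det : ℤ) : R))
    (p : Ideal (invariants a R)) : IsFlat a (zeroSet a R p) := by
  intro i
  constructor
  · intro hi v hv
    exact Set.mem_iInter₂.mp hv i hi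
  · intro hi
    refine mem_zeroSet.mpr ((vanishingIdeal_singleton_le_iff a R p i).mpr ⟨?_, fun w hw => ?_⟩)
    · obtain ⟨A⟩ := exists_adaptedBasis a hrank (zeroSet a R p)
      have h := smul_eq_sum_smul_of_lieKernel a (invU a R) (sum_smul_invU a R) i A.τ A.mat.det
        (A.coef i) (A.det_smul_eq i)
      have h1 : A.mat.det • invU a R i ∈ p := by
        rw [h, Fintype.sum_sum_type]
        refine p.add_mem (p.sum_mem fun j _ => ?_) ?_
        · exact zsmul_mem
            ((vanishingIdeal_singleton_le_iff a R p _).mp (mem_zeroSet.mp (A.τ_mem j))).1 _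
        · simp [A.coef_inr_eq_zero i hi]
      rw [← Int.cast_smul_eq_zsmul R, Algebra.smul_def] at h1
      exact (Ideal.unit_mul_mem_iff_mem p ((A.isUnit_det R hR).map (algebraMap R _))).mp h1
    · by_contra hwp
      refine hw (hi (Set.mem_iInter₂.mpr fun j hj => ?_))
      exact mulVec_eq_zero_of_mem_zeroSet hwp hj

/-- Every point lies in a chart around the stratum containing it. -/
lemma exists_chartFn_notMem {p : Ideal (invariants a R)} (hp : p.IsPrime) :
    ∃ w, (∀ i ∈ zeroSet a R p, (a *ᵥ w) i = 0) ∧ chartFn a R (zeroSet a R p) w ∉ p := by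
  obtain ⟨w, hw, h⟩ := exists_invMono_notMem hp
  refine ⟨w, fun i hi => mulVec_eq_zero_of_mem_zeroSet hw hi, fun hmem => ?_⟩
  rw [chartFn, hp.mul_mem_iff_mem_or_mem, hp.prod_mem_iff] at hmem
  rcases hmem with hmem | ⟨i, hi, hmem⟩
  · exact hw hmem
  · obtain ⟨h1, h2⟩ := (Finset.mem_filter.mp hi).2
    exact h i hmem h1 h2

lemma vanishingIdeal_singleton_not_le_of_chartFn_notMem {p : Ideal (invariants a R)}
    {F : Finset (Fin n)} {w : Fin d → ℤ} (h : chartFn a R F w ∉ p) {i : Fin n} (hi : i ∉ F) :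
    ¬ vanishingIdeal a R {i} ≤ p := by
  intro hle
  obtain ⟨h1, h2⟩ := (vanishingIdeal_singleton_le_iff a R p i).mp hle
  by_cases hw : (a *ᵥ w) i = 0
  · exact h (p.mul_mem_left _ (Ideal.mem_of_dvd p (Finset.dvd_prod_of_mem _
      (Finset.mem_filter.mpr ⟨Finset.mem_univ i, hi, hw⟩)) h1))
  · exact h (p.mul_mem_right _ (h2 w hw))

end Partition

/-! ### Strata and their charts -/

section AffineSpace

/-- The polynomial ring is presented by its variables, without relations. -/
lemma isStandardSmoothOfRelativeDimension_mvPolynomial (R : Type u) [CommRing R] (κ : Type u)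
    [Finite κ] :
    Algebra.IsStandardSmoothOfRelativeDimension (Nat.card κ) R (MvPolynomial κ R) := by
  let P : Algebra.PreSubmersivePresentation R
      (MvPolynomial κ R ⧸ Ideal.span (Set.range (PEmpty.elim : PEmpty.{1} → MvPolynomial κ R)))
      κ PEmpty.{1} := Algebra.PreSubmersivePresentation.naive PEmpty.elim (fun i => i.elim)
  have hP : IsUnit P.jacobian := by
    rw [Algebra.PreSubmersivePresentation.jacobian_eq_jacobiMatrix_det, det_isEmpty, map_one]
    exact isUnit_one
  let Q : Algebra.SubmersivePresentation R _ κ PEmpty.{1} := ⟨P, hP⟩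
  have hbot : Ideal.span (Set.range (PEmpty.elim : PEmpty.{1} → MvPolynomial κ R)) = ⊥ := by
    rw [Set.range_eq_empty, Ideal.span_empty]
  refine (Q.ofAlgEquiv ((Ideal.quotientEquivAlgOfEq R hbot).trans
    (AlgEquiv.quotientBot R _))).isStandardSmoothOfRelativeDimension ?_
  simp [Algebra.Presentation.dimension]

lemma smoothOfRelativeDimension_comp_of_isOpenImmersion {X Y Z : Scheme.{u}} {N : ℕ} (f : X ⟶ Y)
    [IsOpenImmersion f] (g : Y ⟶ Z) (hg : SmoothOfRelativeDimension N g) :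
    SmoothOfRelativeDimension N (f ≫ g) := by
  have h := smoothOfRelativeDimension_comp 0 N f g
  rwa [zero_add] at h

instance smoothOfRelativeDimension_affSp (R : Type u) [CommRing R] (N : ℕ) :
    SmoothOfRelativeDimension N
      (AffSp N (Spec (CommRingCat.of R)) ↘ Spec (CommRingCat.of R)) := by
  have h := isStandardSmoothOfRelativeDimension_mvPolynomial R (ULift.{u} (Fin N))
  rw [Nat.card_ulift, Nat.card_fin] at h
  have h1 : SmoothOfRelativeDimension N (Spec.map (CommRingCat.ofHom
      (MvPolynomial.C : R →+* MvPolynomial (ULift.{u} (Fin N)) R))) := by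
    rw [HasRingHomProperty.Spec_iff (P := @SmoothOfRelativeDimension N)]
    refine RingHom.locally_of RingHom.isStandardSmoothOfRelativeDimension_respectsIso _ ?_
    exact (RingHom.isStandardSmoothOfRelativeDimension_algebraMap N).mpr h
  rw [← AffineSpace.SpecIso_inv_over (n := ULift.{u} (Fin N)) (CommRingCat.of R)] at h1
  have h2 := smoothOfRelativeDimension_comp_of_isOpenImmersion
    (AffineSpace.SpecIso (ULift.{u} (Fin N)) (CommRingCat.of R)).hom _ h1
  rwa [Iso.hom_inv_id_assoc] at h2

end AffineSpace

section Pullback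

/-- A fibre product `U ×_Y Z` that maps into a subscheme `O` of `Z` is also `U ×_Y O`. -/
lemma isPullback_of_mono {V U Z O Y : Scheme.{u}} {j : V ⟶ U} {p : V ⟶ Z} {f : U ⟶ Y} {c : Z ⟶ Y}
    (h : IsPullback j p f c) (o : O ⟶ Z) [Mono o] (p' : V ⟶ O) (hp : p' ≫ o = p) :
    IsPullback j p' f (o ≫ c) := by
  have h1 : IsPullback (𝟙 V) p' p o := by
    refine ⟨⟨by rw [Category.id_comp, hp]⟩, ⟨Limits.PullbackCone.IsLimit.mk _ (fun s => s.fst)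
      (fun s => Category.comp_id _) (fun s => ?_) (fun s m h1 _ => ?_)⟩⟩
    · rw [← cancel_mono o, Category.assoc, hp, s.condition]
    · rw [← h1, Category.comp_id]
  simpa using h1.paste_horiz h

end Pullback

section Strata

lemma range_comap_mk {A : Type u} [CommRing A] (I : Ideal A) :
    Set.range (PrimeSpectrum.comap (Ideal.Quotient.mk I)) =
      PrimeSpectrum.zeroLocus (I : Set A) := by
  have h := range_comap_of_surjective (A ⧸ I) (Ideal.Quotient.mk I) Ideal.Quotient.mk_surjective
  rwa [Ideal.mk_ker] at h

variable {n d : ℕ} (a : Matrix (Fin n) (Fin d) ℤ) (R : Type u) [CommRing R]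

lemma mem_nonvanishing_iff (F : Finset (Fin n)) (y : hypertoric a R) :
    y ∈ nonvanishing a R F ↔ ∀ i ∉ F, ¬ vanishingIdeal a R {i} ≤ y.asIdeal := by
  change y ∈ ⋂ i ∈ (Fᶜ : Finset (Fin n)), (vanishingLocus a R i)ᶜ ↔ _
  simp only [Set.mem_iInter, Finset.mem_compl, Set.mem_compl_iff]
  rfl

lemma range_closedStratumι (F : Finset (Fin n)) :
    Set.range (closedStratumι a R F) =
      PrimeSpectrum.zeroLocus (vanishingIdeal a R F : Set (invariants a R)) := by
  exact range_comap_mk _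

/-- The stratum of `F` consists of the points at which `z_i = w_i = 0` exactly for `i ∈ F`. -/
lemma mem_range_stratumι_iff (F : Finset (Fin n)) (y : hypertoric a R) :
    y ∈ Set.range (stratumι a R F) ↔ zeroSet a R y.asIdeal = F := by
  have h1 : y ∈ Set.range (stratumι a R F) ↔
      y ∈ Set.range (closedStratumι a R F) ∧ y ∈ nonvanishing a R F := by
    constructor
    · rintro ⟨x, rfl⟩
      exact ⟨⟨_, rfl⟩, x.2⟩
    · rintro ⟨⟨x, rfl⟩, hx⟩
      exact ⟨⟨x, hx⟩, rfl⟩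
  rw [h1, range_closedStratumι, mem_nonvanishing_iff]
  change vanishingIdeal a R F ≤ y.asIdeal ∧ _ ↔ _
  rw [vanishingIdeal_le_iff]
  constructor
  · rintro ⟨h2, h3⟩
    ext i
    rw [mem_zeroSet]
    exact ⟨fun h => by_contra fun hi => h3 i hi h, h2 i⟩
  · rintro rfl
    exact ⟨fun i hi => mem_zeroSet.mp hi, fun i hi h => hi (mem_zeroSet.mpr h)⟩

lemma isImmersion_stratumι (F : Finset (Fin n)) : IsImmersion (stratumι a R F) := by
  have : IsClosedImmersion (closedStratumι a R F) :=
    IsClosedImmersion.spec_of_surjective _ Ideal.Quotient.mk_surjective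
  rw [stratumι]
  infer_instance

lemma origin_comp_hypertoricToBase {ι : Type} [Fintype ι] [DecidableEq ι]
    (b : Matrix ι (Fin d) ℤ) : origin b R ≫ hypertoricToBase b R = 𝟙 _ := by
  rw [origin, hypertoricToBase, ← Spec.map_comp, ← CommRingCat.ofHom_comp]
  have h : (evalOrigin b R).toRingHom.comp (algebraMap R (invariants b R)) = RingHom.id R :=
    RingHom.ext fun r => (evalOrigin b R).commutes r
  rw [h]
  exact Spec.map_id _

variable {a}

/-- The chart of `𝔐(𝒜)` at the stratum of `F` given by a vector `w` orthogonal to the `a_i` with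
`i ∈ F`. -/
lemma exists_stratumChart (ha : ∀ i, a i ≠ 0)
    (hR : ∀ t : Fin d → Fin n, (a.submatrix t id).det ≠ 0 →
      IsUnit (((a.submatrix t id).det : ℤ) : R))
    {F : Finset (Fin n)} (hF : IsFlat a F) (A : AdaptedBasis a F) (w : Fin d → ℤ)
    (hw : ∀ i ∈ F, (a *ᵥ w) i = 0) :
    ∃ (U V : Scheme.{u}) (f : U ⟶ hypertoric a R)
      (g : U ⟶ AffSp (2 * A.m) (hypertoric (localization a F) R)) (j : V ⟶ U)
      (p : V ⟶ stratum a R F) (k : V ⟶ AffSp (2 * A.m) (Spec (CommRingCat.of R))),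
      IsOpenImmersion f ∧
      (∀ y : hypertoric a R, y ∈ Set.range f ↔ chartFn a R F w ∉ y.asIdeal) ∧
      IsOpenImmersion g ∧ IsDominant g ∧
      g ≫ (AffSp (2 * A.m) (hypertoric (localization a F) R) ↘ _) ≫
        hypertoricToBase (localization a F) R = f ≫ hypertoricToBase a R ∧
      IsPullback j p f (stratumι a R F) ∧ IsOpenImmersion k ∧ IsDominant k ∧
      j ≫ g = k ≫ AffineSpace.map _ (origin (localization a F) R) ∧
      k ≫ (AffSp (2 * A.m) (Spec (CommRingCat.of R)) ↘ _) =
        p ≫ stratumι a R F ≫ hypertoricToBase a R := by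
  obtain ⟨φ, h1, h2, h3, h4, h5⟩ := A.exists_chart R hR ha hF w hw
  obtain ⟨U, V, f, g, j, p, k, hf, hrange, hg, hg', hover, hpb, hk, hk', hjk, hover'⟩ :=
    exists_schemeChart (evalOrigin (localization a F) R) (vanishingIdeal a R F)
      (chartFn a R F w) A.m φ h1 h2 h3 h4 h5
  have hsub : Set.range p ⊆ Set.range (closedStratumι a R F ⁻¹ᵁ nonvanishing a R F).ι := by
    rintro _ ⟨v, rfl⟩
    rw [Scheme.Opens.range_ι]
    change closedStratumι a R F (p v) ∈ nonvanishing a R F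
    have hc : closedStratumι a R F (p v) = f (j v) := by
      rw [← Scheme.Hom.comp_apply, ← Scheme.Hom.comp_apply, hpb.w]
      rfl
    have hD : chartFn a R F w ∉ (f (j v)).asIdeal :=
      (Set.ext_iff.mp hrange _).mp ⟨j v, rfl⟩
    rw [hc, mem_nonvanishing_iff]
    intro i hi
    exact vanishingIdeal_singleton_not_le_of_chartFn_notMem hD hi
  refine ⟨U, V, f, g, j, IsOpenImmersion.lift _ p hsub, k, hf, Set.ext_iff.mp hrange, hg, hg',
    hover, isPullback_of_mono hpb _ _ (IsOpenImmersion.lift_fac _ _ _), hk, hk', hjk, ?_⟩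
  rw [stratumι, Category.assoc, IsOpenImmersion.lift_fac_assoc, hover', closedStratumι,
    hypertoricToBase, ← Spec.map_comp]
  rfl

end Strata

/-! ### Normal slices and the stratification -/

section NormalSlice

variable {n d : ℕ} (a : Matrix (Fin n) (Fin d) ℤ) (R : Type u) [CommRing R]

/-- The charts are indexed by the vectors orthogonal to the `a_i` with `i ∈ F`. -/
theorem isNormalSlice (ha : ∀ i, a i ≠ 0) (hrank : rank a = d)
    (hR : ∀ t : Fin d → Fin n, (a.submatrix t id).det ≠ 0 →
      IsUnit (((a.submatrix t id).det : ℤ) : R))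
    {F : Finset (Fin n)} (hF : IsFlat a F) :
    IsNormalSlice (hypertoricToBase (localization a F) R) (origin (localization a F) R)
      (hypertoricToBase a R) (stratumι a R F) (2 * (d - rank (localization a F))) := by
  obtain ⟨A⟩ := exists_adaptedBasis a hrank F
  have hm : d - rank (localization a F) = A.m := by
    rw [A.rank_eq]
    have := A.r_add_m
    omega
  rw [hm]
  choose U V f g j p k hf hrange hg hg' hover hpb hk hk' hjk hover' using
    fun w : {w : Fin d → ℤ // ∀ i ∈ F, (a *ᵥ w) i = 0} =>
      exists_stratumChart R ha hR hF A w.1 w.2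
  have hcover : ∀ z : stratum a R F, ∃ w, stratumι a R F z ∈ Set.range (f w) := by
    intro z
    have hz := (mem_range_stratumι_iff a R F _).mp ⟨z, rfl⟩
    obtain ⟨w, hw, hw'⟩ := exists_chartFn_notMem (stratumι a R F z).isPrime
    rw [hz] at hw hw'
    exact ⟨⟨w, hw⟩, (hrange ⟨w, hw⟩ _).mpr hw'⟩
  refine ⟨origin_comp_hypertoricToBase R _, isImmersion_stratumι a R F, ?_,
    ULift.{u} {w : Fin d → ℤ // ∀ i ∈ F, (a *ᵥ w) i = 0}, fun w => U w.down,
    fun w => f w.down, fun w => g w.down, fun w => (hpb w.down).isoPullback.inv ≫ k w.down,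
    fun w => ?_, fun z => ?_, fun w => ⟨?_, hg' w.down, hover w.down⟩, fun w => ⟨?_, ?_⟩⟩
  · have hp : ∀ w, IsOpenImmersion (p w) := fun w =>
      MorphismProperty.of_isPullback (P := @IsOpenImmersion) (hpb w) (hf w)
    have hpcover : ∀ z : stratum a R F, ∃ w v, p w v = z := by
      intro z
      obtain ⟨w, y, hy⟩ := hcover z
      obtain ⟨v, -, hv⟩ := Scheme.Pullback.exists_preimage_pullback y z hy
      refine ⟨w, (hpb w).isoPullback.inv v, ?_⟩
      rw [← Scheme.Hom.comp_apply, IsPullback.isoPullback_inv_snd, hv]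
    let 𝒰 : (stratum a R F).OpenCover :=
      Scheme.Cover.mkOfCovers {w : Fin d → ℤ // ∀ i ∈ F, (a *ᵥ w) i = 0} V p hpcover hp
    have := HasRingHomProperty.instIsZariskiLocalAtSource
      (P := @SmoothOfRelativeDimension.{u} (2 * A.m))
    refine IsZariskiLocalAtSource.of_openCover (P := @SmoothOfRelativeDimension (2 * A.m)) 𝒰
      fun w => ?_
    change SmoothOfRelativeDimension (2 * A.m) (p w ≫ stratumι a R F ≫ hypertoricToBase a R)
    rw [← hover' w]
    have := hk w
    exact smoothOfRelativeDimension_comp_of_isOpenImmersion _ _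
      (smoothOfRelativeDimension_affSp R _)
  · have := hf w.down
    infer_instance
  · obtain ⟨w, hw⟩ := hcover z
    exact ⟨⟨w⟩, hw⟩
  · have := hg w.down
    infer_instance
  · dsimp only
    rw [← (hpb w.down).isoPullback_inv_fst, Category.assoc, Category.assoc, hjk]
  · have := hk' w.down
    dsimp only
    infer_instance

/-- The closure of the stratum of `F` is the closed subset `z_i = w_i = 0 (i ∈ F)`: the stratum
contains the locus in it where `z_i w_i ≠ 0` for all `i ∉ F`, which is dense because in the chart
around it, the function `∏ z_i w_i` is not a zero divisor on `{0} × 𝔸^m × 𝔾_m^m`. -/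
lemma closure_range_stratumι (ha : ∀ i, a i ≠ 0) (hrank : rank a = d)
    (hR : ∀ t : Fin d → Fin n, (a.submatrix t id).det ≠ 0 →
      IsUnit (((a.submatrix t id).det : ℤ) : R))
    {F : Finset (Fin n)} (hF : IsFlat a F) :
    closure (Set.range (stratumι a R F)) =
      {y : hypertoric a R | F ⊆ zeroSet a R y.asIdeal} := by
  have hmem : ∀ y : hypertoric a R, F ⊆ zeroSet a R y.asIdeal ↔
      vanishingIdeal a R F ≤ y.asIdeal := by
    intro y
    rw [vanishingIdeal_le_iff]
    exact ⟨fun h i hi => mem_zeroSet.mp (h hi), fun h i hi => mem_zeroSet.mpr (h i hi)⟩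
  refine subset_antisymm ?_ ?_
  · refine closure_minimal ?_ ?_
    · intro y hy
      exact ((mem_range_stratumι_iff a R F y).mp hy).ge
    · have h : {y : hypertoric a R | F ⊆ zeroSet a R y.asIdeal} =
          PrimeSpectrum.zeroLocus (vanishingIdeal a R F : Set (invariants a R)) :=
        Set.ext hmem
      rw [h]
      exact PrimeSpectrum.isClosed_zeroLocus _
  · intro y hy
    obtain ⟨A⟩ := exists_adaptedBasis a hrank F
    obtain ⟨φ, -, -, h3, -, h5⟩ := A.exists_chart R hR ha hF 0 (by simp)
    refine (PrimeSpectrum.isTopologicalBasis_basic_opens.mem_closure_iff).mpr ?_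
    rintro _ ⟨r, rfl⟩ hr
    -- A point of the closed subset lies on the stratum if `∏ z_i w_i` does not vanish there.
    obtain ⟨p, hp, hFp, hp'⟩ : ∃ p : Ideal (invariants a R), p.IsPrime ∧
        vanishingIdeal a R F ≤ p ∧ r * chartFn a R F 0 ∉ p := by
      by_contra! hcon
      have hrad : r * chartFn a R F 0 ∈ (vanishingIdeal a R F).radical := by
        rw [Ideal.radical_eq_sInf, Ideal.mem_sInf]
        exact fun p hp => hcon p hp.2 hp.1
      obtain ⟨N, hN⟩ := hrad
      have h0 := (h3 _).mpr hN
      rw [mul_pow, map_mul, map_mul, map_pow φ (chartFn a R F 0), map_pow _ (φ (chartFn a R F 0)),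
        mul_right_mem_nonZeroDivisors_eq_zero_iff (pow_mem h5 N), h3] at h0
      exact hr (y.isPrime.mem_of_pow_mem N ((hmem y).mp hy h0))
    rw [hp.mul_mem_iff_mem_or_mem, not_or] at hp'
    refine ⟨⟨p, hp⟩, hp'.1, (mem_range_stratumι_iff a R F _).mpr (subset_antisymm ?_
      ((hmem ⟨p, hp⟩).mpr hFp))⟩
    intro i hi
    by_contra hiF
    exact vanishingIdeal_singleton_not_le_of_chartFn_notMem hp'.2 hiF (mem_zeroSet.mp hi)

theorem isStratification (ha : ∀ i, a i ≠ 0) (hrank : rank a = d)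
    (hR : ∀ t : Fin d → Fin n, (a.submatrix t id).det ≠ 0 →
      IsUnit (((a.submatrix t id).det : ℤ) : R)) :
    IsStratification (B := (Flat a)ᵒᵈ) (hypertoricToBase a R)
      (fun F => stratum a R (OrderDual.ofDual F).1)
      (fun F => stratumι a R (OrderDual.ofDual F).1)
      (fun F => hypertoric (localization a (OrderDual.ofDual F).1) R)
      (fun F => hypertoricToBase (localization a (OrderDual.ofDual F).1) R)
      (fun F => origin (localization a (OrderDual.ofDual F).1) R) := by
  have hslice := fun F : (Flat a)ᵒᵈ => isNormalSlice a R ha hrank hR (OrderDual.ofDual F).2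
  refine ⟨inferInstanceAs (Finite (Flat a)), fun F => (hslice F).immersion, fun F => ?_,
    fun y => ?_, fun F => ⟨_, hslice F⟩, fun F => ?_⟩
  · have := (hslice F).smooth_dim
    exact this.smooth
  · refine ⟨OrderDual.toDual ⟨zeroSet a R y.asIdeal, isFlat_zeroSet hrank hR _⟩,
      (mem_range_stratumι_iff a R _ y).mpr rfl, fun F hF => ?_⟩
    exact Subtype.ext ((mem_range_stratumι_iff a R _ y).mp hF).symm
  · dsimp only
    rw [closure_range_stratumι a R ha hrank hR (OrderDual.ofDual F).2]
    ext y
    simp only [Set.mem_iUnion, mem_range_stratumι_iff, Set.mem_ofPred_eq]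
    constructor
    · intro h
      exact ⟨OrderDual.toDual ⟨zeroSet a R y.asIdeal, isFlat_zeroSet hrank hR _⟩, h, rfl⟩
    · rintro ⟨F', hle, h⟩
      rw [h]
      exact hle

end NormalSlice

end Hypertoric

end

theorem lemma2p2 {n d : ℕ} (a : Matrix (Fin n) (Fin d) ℤ)
    (ha : ∀ i, a i ≠ 0) (hrank : Hypertoric.rank a = d)
    (R : Type u) [CommRing R]
    (hR : ∀ t : Fin d → Fin n, (a.submatrix t id).det ≠ 0 →
      IsUnit (((a.submatrix t id).det : ℤ) : R)) :
    (∀ F : Finset (Fin n), Hypertoric.IsFlat a F →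
      Hypertoric.IsNormalSlice
        (Hypertoric.hypertoricToBase (Hypertoric.localization a F) R)
        (Hypertoric.origin (Hypertoric.localization a F) R)
        (Hypertoric.hypertoricToBase a R)
        (Hypertoric.stratumι a R F)
        (2 * (d - Hypertoric.rank (Hypertoric.localization a F)))) ∧
    Hypertoric.IsStratification (B := (Hypertoric.Flat a)ᵒᵈ)
      (Hypertoric.hypertoricToBase a R)
      (fun F => Hypertoric.stratum a R (OrderDual.ofDual F).1)
      (fun F => Hypertoric.stratumι a R (OrderDual.ofDual F).1)
      (fun F => Hypertoric.hypertoric (Hypertoric.localization a (OrderDual.ofDual F).1) R)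
      (fun F => Hypertoric.hypertoricToBase (Hypertoric.localization a (OrderDual.ofDual F).1) R)
      (fun F => Hypertoric.origin (Hypertoric.localization a (OrderDual.ofDual F).1) R) := by
  exact ⟨fun F hF => Hypertoric.isNormalSlice a R ha hrank hR hF,
    Hypertoric.isStratification a R ha hrank hR⟩
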